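/- Let $n\ge 1$ be an integer and, for $i=1,2$, let $K_i(x)=x_i^{2n-1}/|x|^{2n}$ for $x=(x_1,x_2)\in\mathbb{R}^2\setminus\{0\}$. For a compact set $E\subset\mathbb{R}^2$ define $$\gamma_n(E)=\sup|\langle T,1\rangle|,$$ the supremum being taken over all real distributions $T$ on $\mathbb{R}^2$ supported on $E$ such that for $i=1,2$ the potential $K_i*T$ belongs to the closed unit ball of $L^\infty(\mathbb{R}^2)$. Then $\gamma_n$ is finite and outer regular: if $(E_k)_k$ is a decreasing sequence of compact subsets of $\mathbb{R}^2$ with intersection $E=\bigcap_k E_k$, then $\gamma_n(E_k)<\infty$ for all $k$ and $$\gamma_n(E)=\lim_{k\to\infty}\gamma_n(E_k).$$ -/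

import Mathlib

open MeasureTheory Filter Topology Distributions
open scoped ENNReal ContDiff

/-- The Euclidean plane. -/
abbrev Plane : Type := EuclideanSpace ℝ (Fin 2)

/-- Test functions: real-valued, smooth, compactly supported functions on the plane. -/
abbrev TestFn : Type := 𝓓((⊤ : TopologicalSpace.Opens Plane), ℝ)

/-- Real distributions on the plane. -/
abbrev RealDistrib : Type := 𝓓'((⊤ : TopologicalSpace.Opens Plane), ℝ)

/-! ### Pairing a compactly supported distribution with a smooth function -/

/-- The product `χ g` of a test function and a smooth function, as a test function. -/
noncomputable def mulSmooth (χ : TestFn) (g : Plane → ℝ) (hg : ContDiff ℝ ∞ g) : TestFn where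
  toFun := fun x => χ x * g x
  contDiff' := χ.contDiff.mul hg
  hasCompactSupport' := χ.hasCompactSupport.mul_right
  tsupport_subset' := fun _ _ => trivial

/-- Every compact set has a cut-off: a test function equal to `1` on a neighbourhood of it. -/
theorem exists_cutoff {S : Set Plane} (hS : IsCompact S) :
    ∃ χ : TestFn, ∀ᶠ x in 𝓝ˢ S, χ x = 1 := by
  obtain ⟨t, ht, hSt⟩ := exists_compact_superset hS
  obtain ⟨f, hf1, hf0, -⟩ := exists_contMDiffMap_one_nhds_of_subset_interior
    (modelWithCornersSelf ℝ Plane) (n := (⊤ : ℕ∞)) hS.isClosed hSt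
  exact ⟨⟨f, f.contMDiff.contDiff, HasCompactSupport.intro ht (fun x hx => hf0 x hx),
    fun _ _ => trivial⟩, hf1⟩

/-- A chosen cut-off of a compact set. -/
noncomputable def cutoff {S : Set Plane} (hS : IsCompact S) : TestFn :=
  (exists_cutoff hS).choose

theorem cutoff_eventually {S : Set Plane} (hS : IsCompact S) :
    ∀ᶠ x in 𝓝ˢ S, cutoff hS x = 1 :=
  (exists_cutoff hS).choose_spec

/-- The value `⟨T, g⟩` of a compactly supported distribution `T` at a smooth function `g` that
need not have compact support: `⟨T, χ g⟩` for a cut-off `χ` equal to `1` near the support of `T`. -/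
noncomputable def pairSmooth (T : RealDistrib) (hT : IsCompact (Distribution.dsupport T))
    (g : Plane → ℝ) (hg : ContDiff ℝ ∞ g) : ℝ :=
  T (mulSmooth (cutoff hT) g hg)

/-- A distribution vanishes on test functions supported off its support. -/
theorem isVanishingOn_compl_dsupport (T : RealDistrib) :
    Distribution.IsVanishingOn T (Distribution.dsupport T)ᶜ := by
  intro u hu
  have hK : IsCompact (tsupport u) := u.hasCompactSupport
  have hcov : tsupport u ⊆
      ⋃ a : { a // Distribution.IsVanishingOn T a ∧ IsOpen a }, (a : Set Plane) := by
    intro x hx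
    have hx' := hu hx
    rw [Distribution.dsupport_compl_eq] at hx'
    obtain ⟨a, ha, hxa⟩ := hx'
    exact Set.mem_iUnion.2 ⟨⟨a, ha⟩, hxa⟩
  obtain ⟨F, hF⟩ := hK.elim_finite_subcover _ (fun a => a.2.2) hcov
  obtain ⟨ρ, hρ⟩ := SmoothPartitionOfUnity.exists_isSubordinate
    (modelWithCornersSelf ℝ Plane) hK.isClosed (fun a : F => (a.1 : Set Plane))
    (fun a => a.1.2.2) (by simpa [Set.iUnion_subtype] using hF)
  have hsum : u = ∑ a : F, mulSmooth u (ρ a) (ρ a).contMDiff.contDiff := by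
    ext x
    have h0 : (∑ a : F, mulSmooth u (ρ a) (ρ a).contMDiff.contDiff) x = ∑ a : F, u x * ρ a x := by
      rw [FunLike.coe_sum, Finset.sum_apply]
      rfl
    rw [h0]
    rw [← Finset.mul_sum]
    by_cases hx : x ∈ tsupport u
    · have h1 := ρ.sum_eq_one hx
      rw [finsum_eq_sum_of_fintype] at h1
      rw [h1, mul_one]
    · rw [image_eq_zero_of_notMem_tsupport hx, zero_mul]
  rw [hsum, map_sum]
  refine Finset.sum_eq_zero fun a _ => a.1.2.1 _ ?_
  exact (closure_mono (Function.support_mul_subset_right _ _)).trans (hρ a)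

/-- The value `⟨T, g⟩` does not depend on the cut-off. -/
theorem pairSmooth_eq (T : RealDistrib) (hT : IsCompact (Distribution.dsupport T))
    (g : Plane → ℝ) (hg : ContDiff ℝ ∞ g) (χ : TestFn)
    (hχ : ∀ᶠ x in 𝓝ˢ (Distribution.dsupport T), χ x = 1) :
    pairSmooth T hT g hg = T (mulSmooth χ g hg) := by
  rw [pairSmooth, ← sub_eq_zero, ← map_sub]
  apply isVanishingOn_compl_dsupport T
  intro x hx hxT
  have h := (cutoff_eventually hT).and hχ
  have h' : ∀ᶠ y in 𝓝 x, cutoff hT y = 1 ∧ χ y = 1 :=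
    h.filter_mono (nhds_le_nhdsSet hxT)
  refine (notMem_tsupport_iff_eventuallyEq.2 ?_) hx
  filter_upwards [h'] with y hy
  change cutoff hT y * g y - χ y * g y = 0
  rw [hy.1, hy.2, sub_self]

/-! ### The kernels and the potentials -/

/-- The kernel `K_i(x) = x_i^(2n-1) / |x|^(2n)`. -/
noncomputable def kern (n : ℕ) (i : Fin 2) (x : Plane) : ℝ :=
  x i ^ (2 * n - 1) / ‖x‖ ^ (2 * n)

theorem measurable_kern (n : ℕ) (i : Fin 2) : Measurable (kern n i) := by
  unfold kern
  fun_prop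

theorem locallyIntegrable_kern (n : ℕ) (i : Fin 2) : LocallyIntegrable (kern n i) volume := by
  rcases Nat.eq_zero_or_pos n with rfl | hn
  · have : kern 0 i = fun _ => 1 := by
      funext x; simp [kern]
    rw [this]
    exact locallyIntegrable_const 1
  · refine locallyIntegrable_of_norm_le_rpow (C := 1) (α := 1) (by simp) (by simp) ?_
      (measurable_kern n i).aestronglyMeasurable
    refine Eventually.of_forall fun x => ?_
    rw [one_mul, Real.rpow_neg_one, kern, norm_div, norm_pow, norm_pow, norm_norm]
    rcases eq_or_ne x 0 with rfl | hx
    · have : 2 * n ≠ 0 := by omega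
      simp [this]
    have hx' : 0 < ‖x‖ := norm_pos_iff.2 hx
    rw [div_le_iff₀ (by positivity)]
    calc ‖x i‖ ^ (2 * n - 1) ≤ ‖x‖ ^ (2 * n - 1) := by
          gcongr; exact PiLp.norm_apply_le x i
      _ = ‖x‖⁻¹ * ‖x‖ ^ (2 * n) := by
          obtain ⟨m, rfl⟩ : ∃ m, n = m + 1 := ⟨n - 1, by omega⟩
          rw [show 2 * (m + 1) - 1 = 2 * m + 1 by omega, show 2 * (m + 1) = 2 * m + 1 + 1 by omega,
            pow_succ _ (2 * m + 1)]
          field_simp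

/-- The transpose of convolution with `K_i`, applied to a test function:
`x ↦ ∫ K_i(y - x) φ(y) dy`. -/
noncomputable def kernAdj (n : ℕ) (i : Fin 2) (φ : TestFn) (x : Plane) : ℝ :=
  ∫ y, kern n i (y - x) * φ y

theorem contDiff_kernAdj (n : ℕ) (i : Fin 2) (φ : TestFn) : ContDiff ℝ ∞ (kernAdj n i φ) := by
  have hK : LocallyIntegrable (fun x => kern n i (-x)) volume := by
    have h : (fun x => kern n i (-x)) = fun x => (-1) ^ (2 * n - 1) * kern n i x := by
      funext x
      simp only [kern, PiLp.neg_apply, norm_neg]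
      rw [neg_pow, mul_div_assoc]
    rw [h]
    exact (locallyIntegrable_kern n i).smul ((-1 : ℝ) ^ (2 * n - 1))
  have h := φ.hasCompactSupport.contDiff_convolution_right
    (ContinuousLinearMap.mul ℝ ℝ) hK φ.contDiff
  convert h using 1
  funext x
  rw [convolution_def, ← integral_sub_left_eq_self _ volume x]
  simp [kernAdj]

/-- The convolution `K_i * T` of the kernel with a compactly supported distribution, as a
functional on test functions: `⟨K_i * T, φ⟩ = ⟨T, x ↦ ∫ K_i(y - x) φ(y) dy⟩`. -/
noncomputable def potential (n : ℕ) (i : Fin 2) (T : RealDistrib)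
    (hT : IsCompact (Distribution.dsupport T)) (φ : TestFn) : ℝ :=
  pairSmooth T hT (kernAdj n i φ) (contDiff_kernAdj n i φ)

/-- A functional on test functions is (given by integration against) a function in the closed
unit ball of `L^∞(ℝ²)`. -/
def InUnitBallLinfty (S : TestFn → ℝ) : Prop :=
  ∃ f : Lp ℝ ∞ (volume : Measure Plane), ‖f‖ ≤ 1 ∧ ∀ φ : TestFn, S φ = ∫ y, f y * φ y

/-- `T` is a real distribution with compact support, contained in `E`, both of whose potentials
`K_1 * T` and `K_2 * T` lie in the closed unit ball of `L^∞(ℝ²)`. -/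
structure Admissible (n : ℕ) (E : Set Plane) (T : RealDistrib) : Prop where
  isCompact : IsCompact (Distribution.dsupport T)
  subset : Distribution.dsupport T ⊆ E
  bounded : ∀ i : Fin 2, InUnitBallLinfty (potential n i T isCompact)

/-- The capacity `γ_n(E) = sup |⟨T, 1⟩|`, as an element of `[0, ∞]`, the supremum being taken over
all admissible `T`. -/
noncomputable def gammaCap (n : ℕ) (E : Set Plane) : ℝ≥0∞ :=
  ⨆ (T : RealDistrib) (hT : Admissible n E T),
    ENNReal.ofReal |pairSmooth T hT.isCompact (fun _ => 1) contDiff_const|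

/-! ### Coprimality of the symbols of the kernels -/

/-- In an ultrametric group, a term of a vanishing sum is dominated by another one. -/
theorem exists_norm_le_of_sum_eq_zero {M ι : Type*} [SeminormedAddCommGroup M]
    [IsUltrametricDist M] [DecidableEq ι] {s : Finset ι} {f : ι → M} (h : ∑ k ∈ s, f k = 0)
    {a : ι} (ha : a ∈ s) (hfa : ‖f a‖ ≠ 0) : ∃ b ∈ s, b ≠ a ∧ ‖f a‖ ≤ ‖f b‖ := by
  rw [← Finset.add_sum_erase s f ha] at h
  have hne : (s.erase a).Nonempty := by
    by_contra hemp
    rw [Finset.not_nonempty_iff_eq_empty] at hemp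
    rw [hemp, Finset.sum_empty, add_zero] at h
    exact hfa (by rw [h, norm_zero])
  obtain ⟨b, hb, hle⟩ := IsUltrametricDist.exists_norm_finsetSum_le_of_nonempty hne f
  refine ⟨b, Finset.mem_of_mem_erase hb, Finset.ne_of_mem_erase hb, ?_⟩
  rwa [eq_neg_of_add_eq_zero_left h, norm_neg]

/-- The coefficient `binom(m, k) / (2 k + 1)`. -/
def symbolCoeff (m k : ℕ) : ℚ := (m.choose k : ℚ) / (2 * k + 1 : ℕ)

theorem symbolCoeff_ne_zero {m k : ℕ} (hk : k ≤ m) : symbolCoeff m k ≠ 0 := by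
  have := (Nat.choose_pos hk).ne'
  unfold symbolCoeff
  positivity

theorem symbolCoeff_zero_right (m : ℕ) : symbolCoeff m 0 = 1 := by simp [symbolCoeff]

theorem symbolCoeff_rec (m k : ℕ) : (2 * (m + 1 : ℕ) + 1 : ℚ) * symbolCoeff (m + 1) k =
    (m + 1).choose k + 2 * (m + 1 : ℕ) * symbolCoeff m k := by
  have h : ((m + 1 : ℕ) : ℚ) * (m.choose k) = ((m + 1).choose k) * ((m + 1 : ℕ) - k) := by
    rcases le_or_gt k (m + 1) with hk | hk
    · rw [← Nat.cast_sub hk]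
      have := Nat.choose_mul_succ_eq m k
      rw [mul_comm]
      exact_mod_cast this
    · simp [Nat.choose_eq_zero_of_lt hk, Nat.choose_eq_zero_of_lt (Nat.lt_of_succ_lt hk)]
  unfold symbolCoeff
  push_cast at h ⊢
  field_simp
  linear_combination -2 * h

section Padic

variable {p : ℕ} [Fact p.Prime]

theorem norm_symbolCoeff {m k₀ k : ℕ} (hp : p = 2 * k₀ + 1) (h1 : m + 1 < p) (h2 : k ≤ m) :
    ‖((symbolCoeff m k : ℚ_[p]) : PadicAlgCl p)‖ = if k = k₀ then (p : ℝ) else 1 := by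
  have hpp : p.Prime := Fact.out
  rw [PadicAlgCl.norm_extends, symbolCoeff]
  push_cast
  have hc : ‖(m.choose k : ℚ_[p])‖ = 1 := by
    rw [Padic.norm_natCast_eq_one_iff, hpp.coprime_iff_not_dvd]
    intro hd
    have := hd.trans (Dvd.intro _ (Nat.choose_mul_factorial_mul_factorial h2 ▸ mul_assoc _ _ _).symm)
    rw [hpp.dvd_factorial] at this
    omega
  rw [norm_div, hc]
  split_ifs with hk
  · have : (2 * (k : ℚ_[p]) + 1) = (p : ℕ) := by
      rw [hk]; exact_mod_cast congrArg (Nat.cast (R := ℚ_[p])) hp.symm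
    rw [this, Padic.norm_p]
    simp
  · have : (2 * (k : ℚ_[p]) + 1) = (2 * k + 1 : ℕ) := by push_cast; rfl
    rw [this]
    have h3 : ‖((2 * k + 1 : ℕ) : ℚ_[p])‖ = 1 := by
      rw [Padic.norm_natCast_eq_one_iff, hpp.coprime_iff_not_dvd]
      rintro ⟨c, hc⟩
      have : c < 2 := by
        by_contra hcon
        have : p * 2 ≤ p * c := Nat.mul_le_mul_left _ (by omega)
        omega
      interval_cases c <;> omega
    rw [h3, div_one]

theorem not_sum_symbolCoeff_eq_zero_of_one_le_norm {m k₀ : ℕ} (hp : p = 2 * k₀ + 1)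
    (h1 : m + 1 < p) (h2 : k₀ ≤ m) {s : PadicAlgCl p} (hs : 1 ≤ ‖s‖)
    (hs1 : ∑ k ∈ Finset.range (m + 1), ((symbolCoeff m k : ℚ_[p]) : PadicAlgCl p) * s ^ k = 0)
    (hs2 : ∑ k ∈ Finset.range (m + 1),
      ((symbolCoeff m k : ℚ_[p]) : PadicAlgCl p) * s⁻¹ ^ k = 0) : False := by
  have hp1 : (1 : ℝ) < p := by exact_mod_cast (Fact.out : p.Prime).one_lt
  have hk0 : k₀ ≠ 0 := by rintro rfl; omega
  have hnorm (t : PadicAlgCl p) {k : ℕ} (hk : k ∈ Finset.range (m + 1)) :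
      ‖((symbolCoeff m k : ℚ_[p]) : PadicAlgCl p) * t ^ k‖ =
        (if k = k₀ then (p : ℝ) else 1) * ‖t‖ ^ k := by
    rw [norm_mul, norm_pow, norm_symbolCoeff hp h1 (Finset.mem_range_succ_iff.1 hk)]
  have hk0mem : k₀ ∈ Finset.range (m + 1) := Finset.mem_range_succ_iff.2 h2
  have h0mem : 0 ∈ Finset.range (m + 1) := Finset.mem_range_succ_iff.2 (Nat.zero_le _)
  have hs0 : 0 < ‖s‖ := by linarith
  obtain ⟨k, hk, hkk, hle⟩ := exists_norm_le_of_sum_eq_zero hs1 hk0mem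
    (by rw [hnorm s hk0mem, if_pos rfl]; positivity)
  rw [hnorm s hk, hnorm s hk0mem, if_pos rfl, if_neg hkk, one_mul] at hle
  have hlt : ‖s‖ ^ k₀ < ‖s‖ ^ k :=
    lt_of_lt_of_le (lt_mul_of_one_lt_left (by positivity) hp1) hle
  have hs1' : 1 < ‖s‖ := by
    rcases hs.lt_or_eq with h | h
    · exact h
    · rw [← h] at hlt; simp at hlt
  have hle1 : (p : ℝ) * ‖s‖ ^ k₀ ≤ ‖s‖ ^ m :=
    hle.trans (pow_le_pow_right₀ hs (Finset.mem_range_succ_iff.1 hk))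
  obtain ⟨l, hl, hl0, hle2⟩ := exists_norm_le_of_sum_eq_zero hs2 h0mem
    (by rw [hnorm _ h0mem, if_neg hk0.symm]; simp)
  rw [hnorm _ hl, hnorm _ h0mem, if_neg hk0.symm, pow_zero, mul_one, norm_inv, inv_pow,
    ← div_eq_mul_inv, le_div_iff₀ (by positivity), one_mul] at hle2
  split_ifs at hle2 with hlk
  · subst hlk
    have h3 : ‖s‖ ^ l * ‖s‖ ^ l ≤ ‖s‖ ^ m :=
      (mul_le_mul_of_nonneg_right hle2 (by positivity)).trans hle1
    rw [← pow_add, pow_le_pow_iff_right₀ hs1'] at h3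
    omega
  · exact absurd hle2 (not_le.2 (one_lt_pow₀ hs1' hl0))

end Padic

open Polynomial in
theorem isCoprime_symbolCoeff (m : ℕ) :
    IsCoprime (∑ k ∈ Finset.range (m + 1), C (symbolCoeff m k) * X ^ k)
      (∑ k ∈ Finset.range (m + 1), C (symbolCoeff m k) * X ^ (m - k)) := by
  rcases Nat.eq_zero_or_pos m with rfl | hm
  · simp [symbolCoeff_zero_right, isCoprime_one_left]
  obtain ⟨p, hp, h1, h2⟩ := Nat.exists_prime_lt_and_le_two_mul (m + 1) (by omega)
  have : Fact p.Prime := ⟨hp⟩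
  obtain ⟨k₀, hk₀⟩ : ∃ k₀, p = 2 * k₀ + 1 := hp.odd_of_ne_two (by omega)
  have hk₀m : k₀ ≤ m := by omega
  rw [Polynomial.isCoprime_iff_aeval_ne_zero_of_isAlgClosed ℚ (PadicAlgCl p)]
  intro s
  by_contra! hcon
  obtain ⟨hs1, hs2⟩ := hcon
  have hcoe (k : ℕ) : algebraMap ℚ (PadicAlgCl p) (symbolCoeff m k) =
      ((symbolCoeff m k : ℚ_[p]) : PadicAlgCl p) := by
    rw [eq_ratCast, map_ratCast]
  simp only [map_sum, map_mul, map_pow, aeval_C, aeval_X, hcoe] at hs1 hs2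
  have hs0 : s ≠ 0 := by
    rintro rfl
    rw [Finset.sum_range_succ', Finset.sum_eq_zero (by intros; simp)] at hs1
    simp [symbolCoeff_zero_right] at hs1
  have hs3 : ∑ k ∈ Finset.range (m + 1),
      ((symbolCoeff m k : ℚ_[p]) : PadicAlgCl p) * s⁻¹ ^ k = 0 := by
    refine (mul_eq_zero.1 (?_ : s ^ m * _ = 0)).resolve_left (pow_ne_zero m hs0)
    rw [← hs2, Finset.mul_sum]
    refine Finset.sum_congr rfl fun k hk => ?_
    rw [pow_sub₀ _ hs0 (Finset.mem_range_succ_iff.1 hk), inv_pow]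
    ring
  rcases le_total 1 ‖s‖ with h | h
  · exact not_sum_symbolCoeff_eq_zero_of_one_le_norm hk₀ (by omega) hk₀m h hs1 hs3
  · refine not_sum_symbolCoeff_eq_zero_of_one_le_norm (s := s⁻¹) hk₀ (by omega) hk₀m ?_ hs3
      (by rwa [inv_inv])
    rw [norm_inv]
    exact (one_le_inv₀ (norm_pos_iff.2 hs0)).2 h

/-- The symbol of the kernel `x ^ (2 m + 1) / (x ^ 2 + y ^ 2) ^ (m + 1)`, up to a power of the
Laplacian. -/
def kernSymbol {R : Type*} [CommRing R] [Algebra ℚ R] (m : ℕ) (x y : R) : R :=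
  ∑ k ∈ Finset.range (m + 1), algebraMap ℚ R (symbolCoeff m k) * (x ^ (2 * k + 1) *
    y ^ (2 * (m - k)))

theorem map_kernSymbol {R S : Type*} [CommRing R] [Algebra ℚ R] [CommRing S] [Algebra ℚ S]
    (f : R →ₐ[ℚ] S) (m : ℕ) (x y : R) :
    f (kernSymbol m x y) = kernSymbol m (f x) (f y) := by
  simp [kernSymbol]

theorem kernSymbol_zero_right_eq_zero {L : Type*} [Field L] [Algebra ℚ L] {m : ℕ} {y : L}
    (h : kernSymbol m y 0 = 0) : y = 0 := by
  rw [kernSymbol, Finset.sum_range_succ, Finset.sum_eq_zero, zero_add] at h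
  · have hc : algebraMap ℚ L (symbolCoeff m m) ≠ 0 := by
      rw [Ne, map_eq_zero]
      exact symbolCoeff_ne_zero le_rfl
    simpa using (mul_eq_zero.1 h).resolve_left hc
  · intro k hk
    have : m - k ≠ 0 := by have := Finset.mem_range.1 hk; omega
    simp [this]

theorem kernSymbol_eq_zero_imp {L : Type*} [Field L] [Algebra ℚ L] {m : ℕ} {x y : L}
    (h1 : kernSymbol m x y = 0) (h2 : kernSymbol m y x = 0) : x = 0 ∧ y = 0 := by
  rcases eq_or_ne x 0 with rfl | hx
  · exact ⟨rfl, kernSymbol_zero_right_eq_zero h2⟩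
  rcases eq_or_ne y 0 with rfl | hy
  · exact ⟨kernSymbol_zero_right_eq_zero h1, rfl⟩
  exfalso
  have hcop := Polynomial.aeval_ne_zero_of_isCoprime (isCoprime_symbolCoeff m) (x ^ 2 / y ^ 2)
  simp only [map_sum, map_mul, map_pow, Polynomial.aeval_C, Polynomial.aeval_X] at hcop
  rcases hcop with h | h <;> apply h
  · refine (mul_eq_zero.1 (?_ : x * y ^ (2 * m) * _ = 0)).resolve_left (by positivity)
    rw [← h1, kernSymbol, Finset.mul_sum]
    refine Finset.sum_congr rfl fun k hk => ?_
    obtain ⟨l, rfl⟩ := Nat.exists_eq_add_of_le (Finset.mem_range_succ_iff.1 hk)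
    rw [Nat.add_sub_cancel_left, div_pow]
    field_simp
    ring
  · refine (mul_eq_zero.1 (?_ : y * y ^ (2 * m) * _ = 0)).resolve_left (by positivity)
    rw [← h2, kernSymbol, Finset.mul_sum]
    refine Finset.sum_congr rfl fun k hk => ?_
    obtain ⟨l, rfl⟩ := Nat.exists_eq_add_of_le (Finset.mem_range_succ_iff.1 hk)
    rw [Nat.add_sub_cancel_left, div_pow]
    field_simp
    ring

/-- Some power of `x ^ 2 + y ^ 2` is a combination of the symbols of the two kernels. -/
theorem exists_sq_add_sq_pow_eq {R : Type*} [CommRing R] [Algebra ℚ R] (m : ℕ) (x y : R) :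
    ∃ (M : ℕ) (a b : R), (x ^ 2 + y ^ 2) ^ M = a * kernSymbol m x y + b * kernSymbol m y x := by
  have h : x ^ 2 + y ^ 2 ∈ (Ideal.span {kernSymbol m x y, kernSymbol m y x}).radical := by
    rw [Ideal.radical_eq_sInf, Ideal.mem_sInf]
    rintro 𝔭 ⟨hle, h𝔭⟩
    let f : R →ₐ[ℚ] FractionRing (R ⧸ 𝔭) :=
      (IsScalarTower.toAlgHom ℚ (R ⧸ 𝔭) (FractionRing (R ⧸ 𝔭))).comp (Ideal.Quotient.mkₐ ℚ 𝔭)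
    have hf (z : R) : f z = 0 ↔ z ∈ 𝔭 := by
      change algebraMap (R ⧸ 𝔭) (FractionRing (R ⧸ 𝔭)) (Ideal.Quotient.mk 𝔭 z) = 0 ↔ _
      rw [FaithfulSMul.algebraMap_eq_zero_iff, Ideal.Quotient.eq_zero_iff_mem]
    obtain ⟨hx, hy⟩ := kernSymbol_eq_zero_imp (m := m) (x := f x) (y := f y)
      (by rw [← map_kernSymbol, hf]; exact hle (Ideal.subset_span (by simp)))
      (by rw [← map_kernSymbol, hf]; exact hle (Ideal.subset_span (by simp)))
    rw [← hf, map_add, map_pow, map_pow, hx, hy]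
    simp
  obtain ⟨M, hM⟩ := h
  obtain ⟨a, b, hab⟩ := Ideal.mem_span_pair.1 hM
  exact ⟨M, a, b, hab.symm⟩

theorem kernSymbol_zero {R : Type*} [CommRing R] [Algebra ℚ R] (x y : R) :
    kernSymbol 0 x y = x := by
  simp [kernSymbol, symbolCoeff_zero_right]

theorem kernSymbol_succ {R : Type*} [CommRing R] [Algebra ℚ R] (m : ℕ) (x y : R) :
    (2 * (m + 1 : ℕ) + 1 : R) * kernSymbol (m + 1) x y =
      x * (x ^ 2 + y ^ 2) ^ (m + 1) + 2 * (m + 1 : ℕ) * y ^ 2 * kernSymbol m x y := by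
  have h1 : x * (x ^ 2 + y ^ 2) ^ (m + 1) = ∑ k ∈ Finset.range (m + 1 + 1),
      ((m + 1).choose k : R) * (x ^ (2 * k + 1) * y ^ (2 * (m + 1 - k))) := by
    rw [add_pow, Finset.mul_sum]
    refine Finset.sum_congr rfl fun k _ => ?_
    rw [← pow_mul, ← pow_mul]
    ring
  have h2 : y ^ 2 * kernSymbol m x y = ∑ k ∈ Finset.range (m + 1 + 1),
      algebraMap ℚ R (symbolCoeff m k) * (x ^ (2 * k + 1) * y ^ (2 * (m + 1 - k))) := by
    rw [Finset.sum_range_succ, kernSymbol, Finset.mul_sum]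
    have h0 : symbolCoeff m (m + 1) = 0 := by simp [symbolCoeff]
    rw [h0, map_zero, zero_mul, add_zero]
    refine Finset.sum_congr rfl fun k hk => ?_
    obtain ⟨l, rfl⟩ := Nat.exists_eq_add_of_le (Finset.mem_range_succ_iff.1 hk)
    rw [show k + l - k = l by omega, show k + l + 1 - k = l + 1 by omega]
    ring
  rw [h1, mul_assoc _ (y ^ 2), h2, kernSymbol, Finset.mul_sum, Finset.mul_sum,
    ← Finset.sum_add_distrib]
  refine Finset.sum_congr rfl fun k _ => ?_
  have h3 := congrArg (algebraMap ℚ R) (symbolCoeff_rec m k)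
  simp only [map_mul, map_add, map_natCast, map_one, map_ofNat] at h3
  linear_combination (x ^ (2 * k + 1) * y ^ (2 * (m + 1 - k))) * h3

/-! ### Coordinates of the plane and partial derivatives -/

/-- The `i`-th unit vector of the plane. -/
noncomputable def unitVec (i : Fin 2) : Plane := EuclideanSpace.single i 1

/-- The `i`-th partial derivative on test functions. -/
noncomputable def partialD (i : Fin 2) : TestFn →L[ℝ] TestFn :=
  TestFunction.lineDerivCLM ℝ (unitVec i)

theorem partialD_apply (i : Fin 2) (φ : TestFn) (x : Plane) :
    partialD i φ x = fderiv ℝ φ x (unitVec i) := by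
  rw [partialD, TestFunction.lineDerivCLM_eq_fderivCLM, TestFunction.fderivCLM_apply,
    if_pos (by simp)]

theorem TestFn.differentiable (φ : TestFn) : Differentiable ℝ φ :=
  φ.contDiff.differentiable (by simp)

theorem unitVec_apply_self (i : Fin 2) : unitVec i i = 1 := by simp [unitVec]

theorem unitVec_apply_succ (i : Fin 2) : unitVec i (i + 1) = 0 := by
  fin_cases i <;> simp [unitVec]

theorem unitVec_succ_apply (i : Fin 2) : unitVec (i + 1) i = 0 := by
  fin_cases i <;> simp [unitVec]

theorem plane_norm_sq (x : Plane) (i : Fin 2) : ‖x‖ ^ 2 = x i ^ 2 + x (i + 1) ^ 2 := by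
  rw [EuclideanSpace.norm_sq_eq, Fin.sum_univ_two]
  fin_cases i <;> simp [add_comm]

/-- The point with `i`-th coordinate `p.1` and other coordinate `p.2`. -/
noncomputable def ofCoords (i : Fin 2) (p : ℝ × ℝ) : Plane :=
  p.1 • unitVec i + p.2 • unitVec (i + 1)

theorem ofCoords_apply_self (i : Fin 2) (p : ℝ × ℝ) : ofCoords i p i = p.1 := by
  simp [ofCoords, unitVec_apply_self, unitVec_succ_apply]

theorem ofCoords_apply_succ (i : Fin 2) (p : ℝ × ℝ) : ofCoords i p (i + 1) = p.2 := by
  simp [ofCoords, unitVec_apply_self, unitVec_apply_succ]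

theorem continuous_ofCoords (i : Fin 2) : Continuous (ofCoords i) := by
  unfold ofCoords
  fun_prop

theorem measurePreserving_ofCoords (i : Fin 2) : MeasurePreserving (ofCoords i) := by
  have h0 : MeasurePreserving (ofCoords 0) := by
    have e : ofCoords 0 = WithLp.toLp 2 ∘ MeasurableEquiv.finTwoArrow.symm := by
      funext p
      ext k
      fin_cases k
      · exact ofCoords_apply_self 0 p
      · exact ofCoords_apply_succ 0 p
    rw [e]
    exact (PiLp.volume_preserving_toLp (Fin 2)).comp (volume_preserving_finTwoArrow ℝ).symm
  fin_cases i
  · exact h0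
  · have e : ofCoords 1 = ofCoords 0 ∘ Prod.swap := by
      funext p
      change p.1 • unitVec 1 + p.2 • unitVec 0 = p.2 • unitVec 0 + p.1 • unitVec 1
      rw [add_comm]
    change MeasurePreserving (ofCoords 1)
    rw [e]
    exact h0.comp (Measure.measurePreserving_swap (μ := (volume : Measure ℝ))
      (ν := (volume : Measure ℝ)))

theorem measurableEmbedding_ofCoords (i : Fin 2) : MeasurableEmbedding (ofCoords i) := by
  refine (continuous_ofCoords i).measurableEmbedding fun p q h => Prod.ext ?_ ?_
  · rw [← ofCoords_apply_self i p, h, ofCoords_apply_self]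
  · rw [← ofCoords_apply_succ i p, h, ofCoords_apply_succ]

theorem integral_ofCoords (i : Fin 2) (f : Plane → ℝ) :
    ∫ p, f (ofCoords i p) = ∫ x, f x :=
  (measurePreserving_ofCoords i).integral_comp (measurableEmbedding_ofCoords i) f

theorem Integrable.comp_ofCoords (i : Fin 2) {f : Plane → ℝ} (hf : Integrable f) :
    Integrable fun p => f (ofCoords i p) :=
  (measurePreserving_ofCoords i).integrable_comp_of_integrable hf

theorem MeasureTheory.LocallyIntegrable.integrable_mul_testFn {F : Plane → ℝ}
    (hF : LocallyIntegrable F) (φ : TestFn) : Integrable fun x => F x * φ x := by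
  have := hF.integrable_smul_left_of_hasCompactSupport φ.continuous φ.hasCompactSupport
  simpa only [smul_eq_mul, mul_comm] using this

/-! ### Integration by parts across an isolated singularity -/

/-- Integration by parts for a function that is differentiable off the origin, with locally
integrable derivative: in the plane the origin carries no boundary term. -/
theorem integral_mul_partialD {F F' : Plane → ℝ} {i : Fin 2} (hF : LocallyIntegrable F)
    (hF' : LocallyIntegrable F') (h : ∀ x ≠ 0, HasLineDerivAt ℝ F (F' x) x (unitVec i))
    (φ : TestFn) : ∫ x, F x * partialD i φ x = -∫ x, F' x * φ x := by
  have hline (a t : ℝ) : ofCoords (i + 1) (a, t) = a • unitVec (i + 1) + t • unitVec i := by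
    have : i + 1 + 1 = i := by fin_cases i <;> rfl
    simp [ofCoords, this]
  have hslice (a t s : ℝ) : ofCoords (i + 1) (a, t + s) = ofCoords (i + 1) (a, t) +
      s • unitVec i := by
    rw [hline, hline, add_smul, add_assoc]
  have hderiv {G : Plane → ℝ} {G' a t : ℝ}
      (hG : HasLineDerivAt ℝ G G' (ofCoords (i + 1) (a, t)) (unitVec i)) :
      HasDerivAt (fun t => G (ofCoords (i + 1) (a, t))) G' t := by
    unfold HasLineDerivAt at hG
    simp only [← hslice] at hG
    rw [← add_neg_cancel t] at hG
    simpa using hG.comp_add_const t (-t)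
  have h1 := Integrable.comp_ofCoords (i + 1) (hF.integrable_mul_testFn (partialD i φ))
  have h2 := Integrable.comp_ofCoords (i + 1) (hF'.integrable_mul_testFn φ)
  have h3 := Integrable.comp_ofCoords (i + 1) (hF.integrable_mul_testFn φ)
  rw [← integral_ofCoords (i + 1), ← integral_ofCoords (i + 1) (fun x => F' x * φ x)]
  rw [Measure.volume_eq_prod] at h1 h2 h3 ⊢
  rw [integral_prod _ h1, integral_prod _ h2, ← integral_neg]
  refine integral_congr_ae ?_
  filter_upwards [h1.prod_right_ae, h2.prod_right_ae, h3.prod_right_ae,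
    Measure.ae_ne volume (0 : ℝ)] with a h1a h2a h3a ha
  refine integral_mul_deriv_eq_deriv_mul_of_integrable
    (fun t _ => hderiv (h _ fun h0 => ha ?_)) (fun t _ => hderiv ?_) h1a h2a h3a
  · have := ofCoords_apply_self (i + 1) (a, t)
    rw [h0] at this
    exact this.symm
  · rw [partialD_apply]
    exact (φ.differentiable _).hasFDerivAt.hasLineDerivAt _

/-! ### Auxiliary kernels -/

/-- The function `x_i ^ (2 m) / |x| ^ (2 m)`. -/
noncomputable def angularPow (m : ℕ) (i : Fin 2) (x : Plane) : ℝ :=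
  x i ^ (2 * m) / ‖x‖ ^ (2 * m)

/-- The kernel `x_i ^ (2 m) x_j / |x| ^ (2 m + 2)`, where `j ≠ i`. -/
noncomputable def crossKern (m : ℕ) (i : Fin 2) (x : Plane) : ℝ :=
  x i ^ (2 * m) * x (i + 1) / ‖x‖ ^ (2 * m + 2)

theorem abs_angularPow_le (m : ℕ) (i : Fin 2) (x : Plane) : |angularPow m i x| ≤ 1 := by
  rw [angularPow, abs_div, abs_pow, abs_pow, abs_norm]
  refine div_le_one_of_le₀ ?_ (by positivity)
  gcongr
  exact PiLp.norm_apply_le x i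

theorem crossKern_eq (m : ℕ) (i : Fin 2) (x : Plane) :
    crossKern m i x = angularPow m i x * kern 1 (i + 1) x := by
  simp only [crossKern, angularPow, kern]
  rw [div_mul_div_comm, ← pow_add]
  simp

theorem measurable_angularPow (m : ℕ) (i : Fin 2) : Measurable (angularPow m i) := by
  unfold angularPow
  fun_prop

theorem locallyIntegrable_angularPow (m : ℕ) (i : Fin 2) :
    LocallyIntegrable (angularPow m i) volume :=
  (locallyIntegrable_const (1 : ℝ)).mono (measurable_angularPow m i).aestronglyMeasurable
    (Eventually.of_forall fun x => by simpa using abs_angularPow_le m i x)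

theorem locallyIntegrable_crossKern (m : ℕ) (i : Fin 2) :
    LocallyIntegrable (crossKern m i) volume := by
  refine (locallyIntegrable_kern 1 (i + 1)).mono ?_ (Eventually.of_forall fun x => ?_)
  · rw [show crossKern m i = fun x => angularPow m i x * kern 1 (i + 1) x from
      funext (crossKern_eq m i)]
    exact ((measurable_angularPow m i).mul (measurable_kern 1 (i + 1))).aestronglyMeasurable
  · rw [crossKern_eq, norm_mul]
    exact mul_le_of_le_one_left (norm_nonneg _) (abs_angularPow_le m i x)

theorem locallyIntegrable_log_norm :
    LocallyIntegrable (fun x : Plane => Real.log ‖x‖) volume := by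
  have h1 : LocallyIntegrable (fun x : Plane => ‖x‖⁻¹) volume := by
    refine locallyIntegrable_of_norm_le_rpow (C := 1) (α := 1) (by simp) (by simp) ?_
      (by fun_prop)
    exact Eventually.of_forall fun x => by simp [Real.rpow_neg_one]
  have h2 : LocallyIntegrable (fun x : Plane => ‖x‖) volume :=
    continuous_norm.locallyIntegrable
  refine (h1.add h2).mono (Real.measurable_log.comp measurable_norm).aestronglyMeasurable
    (Eventually.of_forall fun x => ?_)
  have h0 : 0 ≤ ‖x‖ := norm_nonneg x
  change |Real.log ‖x‖| ≤ ‖‖x‖⁻¹ + ‖x‖‖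
  rw [Real.norm_of_nonneg (by positivity), abs_le]
  have h3 := Real.log_le_self h0
  have h4 := Real.log_le_self (inv_nonneg.2 h0)
  rw [Real.log_inv] at h4
  have h5 : 0 ≤ ‖x‖⁻¹ := by positivity
  constructor <;> linarith

section Deriv

variable {x : Plane}

theorem hasDerivAt_coord (x : Plane) (v : Plane) (i : Fin 2) :
    HasDerivAt (fun t : ℝ => (x + t • v) i) (v i) 0 := by
  have : (fun t : ℝ => (x + t • v) i) = fun t : ℝ => x i + t * v i := by
    funext t; simp
  rw [this]
  simpa using ((hasDerivAt_id (0 : ℝ)).mul_const (v i)).const_add (x i)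

theorem hasDerivAt_norm_sq_line (x v : Plane) (i : Fin 2) :
    HasDerivAt (fun t : ℝ => ‖x + t • v‖ ^ 2) (2 * x i * v i + 2 * x (i + 1) * v (i + 1)) 0 := by
  simp only [fun t : ℝ => plane_norm_sq (x + t • v) i]
  refine (((hasDerivAt_coord x v i).pow 2).add ((hasDerivAt_coord x v (i + 1)).pow 2)).congr_deriv
    ?_
  simp

theorem hasLineDerivAt_angularPow (m : ℕ) (i : Fin 2) (v : Plane) (hx : x ≠ 0) :
    HasLineDerivAt ℝ (angularPow (m + 1) i)
      (2 * (m + 1 : ℕ) * x i ^ (2 * m + 1) * x (i + 1) *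
        (x (i + 1) * v i - x i * v (i + 1)) / ‖x‖ ^ (2 * (m + 2))) x v := by
  have hN : ‖x‖ ^ 2 ≠ 0 := by simpa using hx
  unfold HasLineDerivAt angularPow
  simp only [pow_mul]
  have h := (((hasDerivAt_coord x v i).pow 2).pow (m + 1)).div
    ((hasDerivAt_norm_sq_line x v i).pow (m + 1)) (by simpa using hx)
  refine h.congr_deriv ?_
  simp only [Pi.pow_apply, zero_smul, add_zero, Nat.add_sub_cancel]
  have hN' := plane_norm_sq x i
  push_cast
  rw [show (‖x‖ ^ 2) ^ (m + 2) = (‖x‖ ^ 2) ^ m * ‖x‖ ^ 2 * ‖x‖ ^ 2 by ring,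
    show (‖x‖ ^ 2) ^ (m + 1) = (‖x‖ ^ 2) ^ m * ‖x‖ ^ 2 by ring]
  have hM : (‖x‖ ^ 2) ^ m ≠ 0 := pow_ne_zero m hN
  generalize (‖x‖ ^ 2) ^ m = M at *
  generalize ‖x‖ ^ 2 = N at *
  field_simp
  rw [hN']
  ring

theorem hasLineDerivAt_angularPow_self (m : ℕ) (i : Fin 2) (hx : x ≠ 0) :
    HasLineDerivAt ℝ (angularPow (m + 1) i)
      (2 * (m + 1 : ℕ) * (kern (m + 1) i x - kern (m + 2) i x)) x (unitVec i) := by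
  have hN : ‖x‖ ≠ 0 := by simpa using hx
  convert hasLineDerivAt_angularPow m i (unitVec i) hx using 1
  rw [unitVec_apply_self, unitVec_apply_succ, kern, kern,
    show 2 * (m + 1) - 1 = 2 * m + 1 by omega, show 2 * (m + 2) - 1 = 2 * m + 3 by omega]
  have hN' := plane_norm_sq x i
  rw [show ‖x‖ ^ (2 * (m + 2)) = ‖x‖ ^ (2 * (m + 1)) * ‖x‖ ^ 2 by ring]
  generalize ‖x‖ ^ (2 * (m + 1)) = M at *
  have : ‖x‖ ^ 2 ≠ 0 := by positivity
  generalize ‖x‖ ^ 2 = N at *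
  by_cases hM : M = 0
  · simp [hM]
  field_simp
  rw [hN']
  ring

theorem hasLineDerivAt_angularPow_succ (m : ℕ) (i : Fin 2) (hx : x ≠ 0) :
    HasLineDerivAt ℝ (angularPow (m + 1) i)
      (-(2 * (m + 1 : ℕ)) * crossKern (m + 1) i x) x (unitVec (i + 1)) := by
  convert hasLineDerivAt_angularPow m i (unitVec (i + 1)) hx using 1
  rw [unitVec_apply_self, unitVec_succ_apply, crossKern]
  ring

theorem hasLineDerivAt_log_norm (v : Plane) (i : Fin 2) (hx : x ≠ 0) :
    HasLineDerivAt ℝ (fun x : Plane => Real.log ‖x‖)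
      ((x i * v i + x (i + 1) * v (i + 1)) / ‖x‖ ^ 2) x v := by
  have hN : ‖x‖ ^ 2 ≠ 0 := by simpa using hx
  have h := ((hasDerivAt_norm_sq_line x v i).log (by simpa using hx)).div_const 2
  unfold HasLineDerivAt
  have e : (fun t : ℝ => Real.log ‖x + t • v‖) = fun t : ℝ => Real.log (‖x + t • v‖ ^ 2) / 2 := by
    funext t
    rw [Real.log_pow]
    push_cast
    ring
  rw [e]
  refine h.congr_deriv ?_
  simp only [zero_smul, add_zero]
  field_simp

theorem hasLineDerivAt_log_norm_unitVec (i : Fin 2) (hx : x ≠ 0) :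
    HasLineDerivAt ℝ (fun x : Plane => Real.log ‖x‖) (kern 1 i x) x (unitVec i) := by
  convert hasLineDerivAt_log_norm (unitVec i) i hx using 1
  simp [kern, unitVec_apply_self, unitVec_apply_succ]

end Deriv

theorem integral_angularPow_mul_partialD_self (m : ℕ) (i : Fin 2) (φ : TestFn) :
    ∫ x, angularPow (m + 1) i x * partialD i φ x =
      2 * (m + 1 : ℕ) * ((∫ x, kern (m + 2) i x * φ x) - ∫ x, kern (m + 1) i x * φ x) := by
  have hK : LocallyIntegrable (fun x => 2 * ((m + 1 : ℕ) : ℝ) *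
      (kern (m + 1) i x - kern (m + 2) i x)) volume :=
    ((locallyIntegrable_kern (m + 1) i).sub (locallyIntegrable_kern (m + 2) i)).smul
      (2 * ((m + 1 : ℕ) : ℝ))
  rw [integral_mul_partialD (locallyIntegrable_angularPow (m + 1) i) hK
    (fun x hx => hasLineDerivAt_angularPow_self m i hx), ← integral_sub
    ((locallyIntegrable_kern _ i).integrable_mul_testFn φ)
    ((locallyIntegrable_kern _ i).integrable_mul_testFn φ), ← integral_const_mul, ← integral_neg]
  congr 1
  funext x
  ring

theorem integral_angularPow_mul_partialD_succ (m : ℕ) (i : Fin 2) (φ : TestFn) :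
    ∫ x, angularPow (m + 1) i x * partialD (i + 1) φ x =
      2 * (m + 1 : ℕ) * ∫ x, crossKern (m + 1) i x * φ x := by
  have hK : LocallyIntegrable (fun x => -(2 * ((m + 1 : ℕ) : ℝ)) * crossKern (m + 1) i x)
      volume := (locallyIntegrable_crossKern (m + 1) i).smul (-(2 * ((m + 1 : ℕ) : ℝ)))
  rw [integral_mul_partialD (locallyIntegrable_angularPow (m + 1) i) hK
    (fun x hx => hasLineDerivAt_angularPow_succ m i hx), ← integral_const_mul, ← integral_neg]
  congr 1
  funext x
  ring

theorem integral_log_norm_mul_partialD (i : Fin 2) (φ : TestFn) :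
    ∫ x, Real.log ‖x‖ * partialD i φ x = -∫ x, kern 1 i x * φ x :=
  integral_mul_partialD locallyIntegrable_log_norm (locallyIntegrable_kern 1 i)
    (fun _ hx => hasLineDerivAt_log_norm_unitVec i hx) φ

/-! ### The radial field -/

/-- The constant `∫ cos ^ (2 m)` over a period. -/
noncomputable def cosMoment (m : ℕ) : ℝ := ∫ θ in (-Real.pi)..Real.pi, Real.cos θ ^ (2 * m)

theorem cosMoment_succ (m : ℕ) :
    2 * (m + 1 : ℕ) * cosMoment (m + 1) = (2 * m + 1) * cosMoment m := by
  rw [cosMoment, show 2 * (m + 1) = 2 * m + 2 by ring, integral_cos_pow, ← cosMoment]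
  simp
  field_simp

theorem cosMoment_pos (m : ℕ) : 0 < cosMoment m := by
  induction m with
  | zero => simp [cosMoment]; positivity
  | succ m ih =>
    have h := cosMoment_succ m
    have h1 : 0 < 2 * ((m + 1 : ℕ) : ℝ) * cosMoment (m + 1) := by rw [h]; positivity
    exact (mul_pos_iff_of_pos_left (by positivity)).1 h1

theorem integral_radial (m : ℕ) (i : Fin 2) (φ : TestFn) :
    (∫ x, kern (m + 1) i x * partialD i φ x) +
      ∫ x, crossKern m i x * partialD (i + 1) φ x = -cosMoment m * φ 0 := by
  rw [← integral_add ((locallyIntegrable_kern _ i).integrable_mul_testFn _)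
    ((locallyIntegrable_crossKern _ i).integrable_mul_testFn _), ← integral_ofCoords i,
    ← integral_comp_polarCoord_symm]
  let ray (θ r : ℝ) : Plane := ofCoords i (r * Real.cos θ, r * Real.sin θ)
  let ψ' (θ r : ℝ) : ℝ := Real.cos θ * partialD i φ (ray θ r) +
    Real.sin θ * partialD (i + 1) φ (ray θ r)
  have hray : ∀ θ r, ray θ r = r • ray θ 1 := by
    intro θ r
    simp only [ray, ofCoords, smul_add, smul_smul, one_mul]
  have hnorm : ∀ θ r, ‖ray θ r‖ ^ 2 = r ^ 2 := by
    intro θ r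
    rw [plane_norm_sq _ i, ofCoords_apply_self, ofCoords_apply_succ]
    linear_combination r ^ 2 * Real.cos_sq_add_sin_sq θ
  have hderiv (θ r : ℝ) : HasDerivAt (fun r => φ (ray θ r)) (ψ' θ r) r := by
    have h1 : HasDerivAt (fun r => ray θ r) (ray θ 1) r := by
      have h2 := (hasDerivAt_id r).smul_const (ray θ 1)
      rw [one_smul] at h2
      exact h2.congr_of_eventuallyEq (Eventually.of_forall fun r => hray θ r)
    refine ((φ.differentiable (ray θ r)).hasFDerivAt.comp_hasDerivAt r h1).congr_deriv ?_
    simp only [ψ', partialD_apply]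
    conv_lhs => rw [show ray θ 1 = Real.cos θ • unitVec i + Real.sin θ • unitVec (i + 1) by
      simp [ray, ofCoords]]
    rw [map_add, map_smul, map_smul, smul_eq_mul, smul_eq_mul]
  have hintegrand : ∀ p ∈ polarCoord.target,
      p.1 • (kern (m + 1) i (ofCoords i (polarCoord.symm p)) *
        partialD i φ (ofCoords i (polarCoord.symm p)) +
        crossKern m i (ofCoords i (polarCoord.symm p)) *
          partialD (i + 1) φ (ofCoords i (polarCoord.symm p))) =
      ψ' p.2 p.1 * Real.cos p.2 ^ (2 * m) := by
    rintro ⟨r, θ⟩ hp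
    have hr : 0 < r := by
      rw [polarCoord_target] at hp
      exact hp.1
    have e : ofCoords i (polarCoord.symm (r, θ)) = ray θ r := rfl
    have hpow (k : ℕ) : ‖ray θ r‖ ^ (2 * k) = r ^ (2 * k) := by rw [pow_mul, hnorm, pow_mul]
    rw [e]
    simp only [ψ', kern, crossKern, smul_eq_mul]
    rw [show 2 * m + 2 = 2 * (m + 1) by ring, hpow]
    simp only [ray, ofCoords_apply_self, ofCoords_apply_succ]
    rw [show 2 * (m + 1) - 1 = 2 * m + 1 by omega]
    field_simp
    ring
  rw [setIntegral_congr_fun polarCoord.open_target.measurableSet hintegrand, polarCoord_target]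
  obtain ⟨R, hR0, hR⟩ : ∃ R : ℝ, 0 < R ∧ ∀ x : Plane, R < ‖x‖ → x ∉ tsupport φ := by
    obtain ⟨R, hR0, hR⟩ := φ.hasCompactSupport.isBounded.subset_ball_lt 0 0
    refine ⟨R, hR0, fun x hx hxs => ?_⟩
    have := hR hxs
    rw [mem_ball_zero_iff] at this
    linarith
  have hfar : ∀ θ r, R < |r| → ray θ r ∉ tsupport φ := by
    intro θ r hr
    refine hR _ ?_
    rwa [show ‖ray θ r‖ = |r| by rw [← abs_norm, ← sq_eq_sq_iff_abs_eq_abs, hnorm]]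
  have hψ'0 : ∀ θ r, R < |r| → ψ' θ r = 0 := by
    intro θ r hr
    have h0 : fderiv ℝ φ (ray θ r) = 0 := by
      by_contra hne
      exact hfar θ r hr (support_fderiv_subset ℝ hne)
    simp only [ψ', partialD_apply, h0]
    simp
  have hcont : Continuous fun p : ℝ × ℝ => ψ' p.2 p.1 * Real.cos p.2 ^ (2 * m) := by
    have hc : Continuous fun p : ℝ × ℝ => ray p.2 p.1 :=
      (continuous_ofCoords i).comp (by fun_prop)
    have h1 := (partialD i φ).continuous.comp hc
    have h2 := (partialD (i + 1) φ).continuous.comp hc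
    simp only [Function.comp_def] at h1 h2
    simp only [ψ']
    fun_prop
  have hint : IntegrableOn (fun p : ℝ × ℝ => ψ' p.2 p.1 * Real.cos p.2 ^ (2 * m))
      (Set.Ioi 0 ×ˢ Set.Ioo (-Real.pi) Real.pi) := by
    refine IntegrableOn.of_forall_sdiff_eq_zero
      (s := Set.Icc 0 R ×ˢ Set.Icc (-Real.pi) Real.pi)
      (hcont.continuousOn.integrableOn_compact (isCompact_Icc.prod isCompact_Icc))
      (measurableSet_Ioi.prod measurableSet_Ioo) ?_
    rintro ⟨r, θ⟩ ⟨⟨hr, hθ⟩, hn⟩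
    have hrR : R < r := by
      by_contra hcon
      exact hn ⟨⟨(Set.mem_Ioi.1 hr).le, not_lt.1 hcon⟩, hθ.1.le, hθ.2.le⟩
    simp only
    rw [hψ'0 θ r (hrR.trans_le (le_abs_self r)), zero_mul]
  have hinner (θ : ℝ) : ∫ r in Set.Ioi 0, ψ' θ r = -φ 0 := by
    have hcs : HasCompactSupport fun r => φ (ray θ r) :=
      HasCompactSupport.intro (isCompact_closedBall (0 : ℝ) R) fun r hr =>
        image_eq_zero_of_notMem_tsupport (hfar θ r (by simpa using hr))
    have hsm : ContDiff ℝ 1 fun r => φ (ray θ r) := by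
      refine (φ.contDiff.of_le (by simp)).comp ?_
      simp only [ray, ofCoords]
      fun_prop
    have h := hcs.integral_Ioi_deriv_eq hsm 0
    simp only [fun r => (hderiv θ r).deriv] at h
    rw [h, hray, zero_smul]
  rw [Measure.volume_eq_prod] at hint ⊢
  rw [IntegrableOn, ← Measure.prod_restrict] at hint
  rw [← Measure.prod_restrict, integral_prod_symm _ hint]
  simp only [integral_mul_const, hinner]
  rw [integral_const_mul, cosMoment, intervalIntegral.integral_of_le (by linarith [Real.pi_pos]),
    integral_Ioc_eq_integral_Ioo]
  ring

/-! ### Constant coefficient operators -/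

theorem partialD_partialD_apply (i j : Fin 2) (φ : TestFn) (x : Plane) :
    partialD i (partialD j φ) x = fderiv ℝ (fderiv ℝ φ) x (unitVec i) (unitVec j) := by
  rw [partialD_apply]
  have e : (partialD j φ : Plane → ℝ) = fun x => fderiv ℝ φ x (unitVec j) :=
    funext (partialD_apply j φ)
  have hd : DifferentiableAt ℝ (fderiv ℝ φ) x :=
    ((φ.contDiff.fderiv_right (m := 1) (by norm_cast)).differentiable (by simp)) x
  rw [e, fderiv_clm_apply hd (differentiableAt_const _)]
  simp

theorem partialD_comm (i j : Fin 2) (φ : TestFn) :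
    partialD i (partialD j φ) = partialD j (partialD i φ) := by
  ext x
  rw [partialD_partialD_apply, partialD_partialD_apply]
  exact (φ.contDiff.contDiffAt.isSymmSndFDerivAt
    (by rw [minSmoothness_of_isRCLikeNormedField]; exact ENat.LEInfty.out)) _ _

/-- The commutative algebra of constant coefficient differential operators on test functions. -/
noncomputable abbrev DiffOp : Subalgebra ℝ (TestFn →L[ℝ] TestFn) :=
  Algebra.adjoin ℝ (Set.range partialD)

theorem DiffOp.mul_comm' (A B : DiffOp) : A * B = B * A := by
  have : IsMulCommutative DiffOp := by
    refine Algebra.isMulCommutative_adjoin ℝ ?_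
    rintro _ ⟨i, rfl⟩ _ ⟨j, rfl⟩
    ext φ : 1
    exact partialD_comm i j φ
  exact this.is_comm.comm A B

noncomputable instance : CommRing DiffOp :=
  { (inferInstance : Ring DiffOp) with mul_comm := DiffOp.mul_comm' }

noncomputable instance : Algebra ℚ DiffOp := Algebra.compHom _ (algebraMap ℚ ℝ)

/-- The `i`-th partial derivative as a differential operator. -/
noncomputable def dOp (i : Fin 2) : DiffOp :=
  ⟨partialD i, Algebra.subset_adjoin (Set.mem_range_self i)⟩

/-- The Laplacian on test functions. -/
noncomputable def lapOp : DiffOp := dOp 0 ^ 2 + dOp 1 ^ 2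

theorem lapOp_eq (i : Fin 2) : lapOp = dOp i ^ 2 + dOp (i + 1) ^ 2 := by
  fin_cases i
  · rfl
  · exact add_comm _ _

/-- The action of a differential operator on a test function. -/
noncomputable def DiffOp.app (A : DiffOp) (φ : TestFn) : TestFn := A.1 φ

namespace DiffOp

theorem app_dOp (i : Fin 2) (φ : TestFn) : app (dOp i) φ = partialD i φ := rfl

theorem app_mul (A B : DiffOp) (φ : TestFn) : app (A * B) φ = app A (app B φ) := rfl

theorem app_add (A B : DiffOp) (φ : TestFn) : app (A + B) φ = app A φ + app B φ := rfl

theorem app_one (φ : TestFn) : app 1 φ = φ := rfl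

theorem app_smul (c : ℝ) (A : DiffOp) (φ : TestFn) : app (c • A) φ = c • app A φ := rfl

theorem app_comm (A B : DiffOp) (φ : TestFn) : app A (app B φ) = app B (app A φ) := by
  rw [← app_mul, mul_comm, app_mul]

end DiffOp

theorem TestFn.add_apply (φ ψ : TestFn) (x : Plane) : (φ + ψ) x = φ x + ψ x := rfl

theorem TestFn.smul_apply (c : ℝ) (φ : TestFn) (x : Plane) : (c • φ) x = c * φ x := rfl

theorem app_lapOp (i : Fin 2) (φ : TestFn) : DiffOp.app lapOp φ =
    partialD i (partialD i φ) + partialD (i + 1) (partialD (i + 1) φ) := by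
  rw [lapOp_eq i, DiffOp.app_add, pow_two, pow_two, DiffOp.app_mul, DiffOp.app_mul]
  rfl

/-- The translate `y ↦ φ (x + y)` of a test function. -/
noncomputable def TestFn.translate (x : Plane) (φ : TestFn) : TestFn where
  toFun := fun y => φ (x + y)
  contDiff' := φ.contDiff.comp (contDiff_const.add contDiff_id)
  hasCompactSupport' := φ.hasCompactSupport.comp_homeomorph (Homeomorph.addLeft x)
  tsupport_subset' := fun _ _ => trivial

theorem TestFn.translate_apply (x : Plane) (φ : TestFn) (y : Plane) :
    φ.translate x y = φ (x + y) := rfl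

theorem TestFn.translate_zero_apply (x : Plane) (φ : TestFn) : φ.translate x 0 = φ x := by
  rw [TestFn.translate_apply, add_zero]

theorem partialD_translate (i : Fin 2) (x : Plane) (φ : TestFn) :
    partialD i (φ.translate x) = (partialD i φ).translate x := by
  ext y
  rw [TestFn.translate_apply, partialD_apply, partialD_apply]
  change fderiv ℝ (fun y => φ (x + y)) y _ = _
  rw [fderiv_comp_add_left]

theorem app_lapOp_translate (x : Plane) (φ : TestFn) :
    DiffOp.app lapOp (φ.translate x) = (DiffOp.app lapOp φ).translate x := by
  rw [app_lapOp 0, app_lapOp 0]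
  simp only [partialD_translate]
  rfl

theorem kernAdj_eq (n : ℕ) (i : Fin 2) (φ : TestFn) (x : Plane) :
    kernAdj n i φ x = ∫ z, kern n i z * φ.translate x z := by
  rw [kernAdj, ← integral_add_left_eq_self _ x]
  simp only [add_sub_cancel_left]
  rfl

theorem LocallyIntegrable.integral_mul_add {F : Plane → ℝ} (hF : LocallyIntegrable F)
    (φ ψ : TestFn) : ∫ x, F x * (φ + ψ) x = (∫ x, F x * φ x) + ∫ x, F x * ψ x := by
  rw [← integral_add (hF.integrable_mul_testFn φ) (hF.integrable_mul_testFn ψ)]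
  simp only [TestFn.add_apply, mul_add]

theorem LocallyIntegrable.integral_mul_smul {F : Plane → ℝ} (c : ℝ) (φ : TestFn) :
    ∫ x, F x * (c • φ) x = c * ∫ x, F x * φ x := by
  rw [← integral_const_mul]
  simp only [TestFn.smul_apply]
  congr 1
  funext x
  ring

/-- `log |x|` is a fundamental solution of the Laplacian, up to a constant. -/
theorem integral_log_norm_mul_lapOp (φ : TestFn) :
    ∫ x : Plane, Real.log ‖x‖ * DiffOp.app lapOp φ x = cosMoment 0 * φ 0 := by
  rw [app_lapOp 0, LocallyIntegrable.integral_mul_add locallyIntegrable_log_norm,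
    integral_log_norm_mul_partialD, integral_log_norm_mul_partialD]
  have h := integral_radial 0 0 φ
  have e : crossKern 0 0 = kern 1 (0 + 1) := by
    funext x
    simp [crossKern, kern]
  rw [e] at h
  linarith

theorem integral_crossKern_mul_partialD (m : ℕ) (i : Fin 2) (φ : TestFn) :
    ∫ x, crossKern (m + 1) i x * partialD i φ x =
      (∫ x, kern (m + 2) i x * partialD (i + 1) φ x) -
        ∫ x, kern (m + 1) i x * partialD (i + 1) φ x := by
  have h1 := integral_angularPow_mul_partialD_succ m i (partialD i φ)
  have h2 := integral_angularPow_mul_partialD_self m i (partialD (i + 1) φ)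
  rw [partialD_comm, h1] at h2
  exact mul_left_cancel₀ (by positivity) h2

theorem integral_crossKern_zero_mul_partialD (i : Fin 2) (φ : TestFn) :
    ∫ x, crossKern 0 i x * partialD i φ x = ∫ x, kern 1 i x * partialD (i + 1) φ x := by
  have e : crossKern 0 i = kern 1 (i + 1) := by
    funext x
    simp [crossKern, kern]
  have h1 := integral_log_norm_mul_partialD (i + 1) (partialD i φ)
  have h2 := integral_log_norm_mul_partialD i (partialD (i + 1) φ)
  rw [partialD_comm, h1] at h2
  rw [e]
  linarith

theorem integral_kern_one_mul_lapOp (i : Fin 2) (φ : TestFn) :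
    ∫ x, kern 1 i x * DiffOp.app lapOp φ x = -cosMoment 0 * partialD i φ 0 := by
  rw [app_lapOp i, LocallyIntegrable.integral_mul_add (locallyIntegrable_kern 1 i),
    ← integral_radial 0 i (partialD i φ), partialD_comm (i + 1) i,
    integral_crossKern_zero_mul_partialD]

theorem integral_kern_mul_lapOp (m : ℕ) (i : Fin 2) (φ : TestFn) :
    ∫ x, kern (m + 2) i x * DiffOp.app lapOp φ x =
      (∫ x, kern (m + 1) i x * partialD (i + 1) (partialD (i + 1) φ) x) -
        cosMoment (m + 1) * partialD i φ 0 := by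
  have h := integral_radial (m + 1) i (partialD i φ)
  rw [partialD_comm (i + 1) i, integral_crossKern_mul_partialD] at h
  rw [app_lapOp i, LocallyIntegrable.integral_mul_add (locallyIntegrable_kern (m + 2) i)]
  linarith

theorem kernAdj_one_lapOp (i : Fin 2) (φ : TestFn) (x : Plane) :
    kernAdj 1 i (DiffOp.app lapOp φ) x = -cosMoment 0 * partialD i φ x := by
  rw [kernAdj_eq, ← app_lapOp_translate, integral_kern_one_mul_lapOp, partialD_translate,
    TestFn.translate_zero_apply]

theorem kernAdj_lapOp (m : ℕ) (i : Fin 2) (φ : TestFn) (x : Plane) :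
    kernAdj (m + 2) i (DiffOp.app lapOp φ) x =
      kernAdj (m + 1) i (partialD (i + 1) (partialD (i + 1) φ)) x -
        cosMoment (m + 1) * partialD i φ x := by
  rw [kernAdj_eq, ← app_lapOp_translate, integral_kern_mul_lapOp, kernAdj_eq, partialD_translate,
    partialD_translate, partialD_translate, TestFn.translate_zero_apply]

/-- The symbol of the `i`-th kernel as a differential operator. -/
noncomputable def kernOp (m : ℕ) (i : Fin 2) : DiffOp := kernSymbol m (dOp i) (dOp (i + 1))

theorem smul_kernSymbol_succ {R : Type*} [CommRing R] [Algebra ℚ R] [Algebra ℝ R] (m : ℕ)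
    (x y : R) : (2 * ((m + 1 : ℕ) : ℝ) + 1) • kernSymbol (m + 1) x y =
      x * (x ^ 2 + y ^ 2) ^ (m + 1) + (2 * ((m + 1 : ℕ) : ℝ)) • (kernSymbol m x y * (y * y)) := by
  have h := kernSymbol_succ m x y
  rw [Algebra.smul_def, Algebra.smul_def]
  simp only [map_add, map_mul, map_natCast, map_one, map_ofNat]
  linear_combination h

theorem kernAdj_lapOp_pow (m : ℕ) (i : Fin 2) (φ : TestFn) (x : Plane) :
    kernAdj (m + 1) i (DiffOp.app (lapOp ^ (m + 1)) φ) x =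
      -((2 * m + 1) * cosMoment m) * DiffOp.app (kernOp m i) φ x := by
  induction m generalizing φ with
  | zero =>
    rw [pow_one, kernAdj_one_lapOp, kernOp, kernSymbol_zero, DiffOp.app_dOp]
    simp
  | succ m ih =>
    rw [pow_succ', DiffOp.app_mul, kernAdj_lapOp, ← DiffOp.app_dOp, ← DiffOp.app_dOp,
      ← DiffOp.app_dOp, DiffOp.app_comm _ (lapOp ^ (m + 1)), DiffOp.app_comm _ (lapOp ^ (m + 1)),
      ih]
    have h := congrArg (fun A => DiffOp.app A φ x) (smul_kernSymbol_succ m (dOp i) (dOp (i + 1)))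
    rw [← lapOp_eq i] at h
    simp only [DiffOp.app_smul, DiffOp.app_add, TestFn.add_apply, TestFn.smul_apply,
      DiffOp.app_mul] at h
    rw [← kernOp, ← kernOp] at h
    have hC := cosMoment_succ m
    push_cast at h hC ⊢
    linear_combination cosMoment (m + 1) * h +
      (DiffOp.app (kernOp m i) (DiffOp.app (dOp (i + 1)) (DiffOp.app (dOp (i + 1)) φ)) x) * hC

/-! ### The logarithmic potential of a test function -/

/-- On a bounded set the derivatives of a convolution with a locally integrable function are
controlled by those of the other factor. -/
theorem norm_iteratedFDeriv_convolution_le {u : Plane → ℝ} (hu : LocallyIntegrable u) {R R' : ℝ}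
    (k : ℕ) {F G : Type} [NormedAddCommGroup F] [NormedSpace ℝ F] [NormedAddCommGroup G]
    [NormedSpace ℝ G] (L : ℝ →L[ℝ] F →L[ℝ] G) {g : Plane → F} (hg : ContDiff ℝ ∞ g)
    (hgR : tsupport g ⊆ Metric.closedBall 0 R) {C : ℝ} (hC : ∀ x, ‖iteratedFDeriv ℝ k g x‖ ≤ C)
    {x : Plane} (hx : x ∈ Metric.closedBall 0 R') :
    ‖iteratedFDeriv ℝ k (convolution u g L volume) x‖ ≤
      ‖L‖ * C * ∫ z in Metric.closedBall 0 (R + R'), |u z| := by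
  have hgc : HasCompactSupport g :=
    HasCompactSupport.of_support_subset_isCompact (isCompact_closedBall _ _)
      ((subset_tsupport g).trans hgR)
  induction k generalizing F G with
  | zero =>
    rw [norm_iteratedFDeriv_zero, convolution_def]
    simp only [norm_iteratedFDeriv_zero] at hC
    have hint : IntegrableOn u (Metric.closedBall 0 (R + R')) :=
      hu.integrableOn_isCompact (isCompact_closedBall _ _)
    have hzero : ∀ z ∉ Metric.closedBall (0 : Plane) (R + R'), L (u z) (g (x - z)) = 0 := by
      intro z hz
      have : x - z ∉ tsupport g := by
        intro hmem
        have h1 := hgR hmem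
        rw [mem_closedBall_zero_iff] at h1 hx hz
        have h2 : ‖z‖ ≤ ‖x‖ + ‖x - z‖ := by
          simpa using norm_sub_le x (x - z)
        linarith
      rw [image_eq_zero_of_notMem_tsupport this, map_zero]
    rw [← setIntegral_eq_integral_of_forall_compl_eq_zero hzero, ← integral_const_mul]
    refine norm_integral_le_of_norm_le (hint.abs.const_mul _) (Eventually.of_forall fun z => ?_)
    calc ‖L (u z) (g (x - z))‖ ≤ ‖L‖ * ‖u z‖ * ‖g (x - z)‖ := L.le_opNorm₂ _ _
      _ ≤ ‖L‖ * ‖u z‖ * C := by gcongr; exact hC _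
      _ = ‖L‖ * C * |u z| := by rw [Real.norm_eq_abs]; ring
  | succ k ih =>
    have hd : fderiv ℝ (convolution u g L volume) =
        convolution u (fderiv ℝ g) (L.precompR Plane) volume :=
      funext fun y => (hgc.hasFDerivAt_convolution_right L hu (hg.of_le (by simp)) y).fderiv
    rw [← norm_iteratedFDeriv_fderiv, hd]
    have hI : 0 ≤ ∫ z in Metric.closedBall (0 : Plane) (R + R'), |u z| :=
      integral_nonneg fun _ => abs_nonneg _
    have hC0 : 0 ≤ C := (norm_nonneg _).trans (hC 0)
    refine (ih (L.precompR Plane) (hg.fderiv_right (by simp))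
      ((tsupport_fderiv_subset ℝ).trans hgR)
      (fun y => by rw [norm_iteratedFDeriv_fderiv]; exact hC y) (hgc.fderiv ℝ)).trans ?_
    gcongr
    exact L.norm_precompR_le Plane

/-- The logarithmic potential of a function. -/
noncomputable def logPot (φ : Plane → ℝ) : Plane → ℝ :=
  convolution (fun x => Real.log ‖x‖) φ (ContinuousLinearMap.mul ℝ ℝ) volume

theorem contDiff_logPot {φ : Plane → ℝ} (h1 : ContDiff ℝ ∞ φ) (h2 : HasCompactSupport φ) :
    ContDiff ℝ ∞ (logPot φ) :=
  h2.contDiff_convolution_right (ContinuousLinearMap.mul ℝ ℝ) locallyIntegrable_log_norm h1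

theorem logPot_eq (φ : TestFn) (x : Plane) :
    logPot φ x = ∫ z, Real.log ‖z‖ * φ.translate x z := by
  rw [logPot, convolution_def, ← integral_neg_eq_self]
  simp [TestFn.translate_apply]

theorem logPot_add (φ ψ : TestFn) (x : Plane) :
    logPot (φ + ψ : TestFn) x = logPot φ x + logPot ψ x := by
  rw [logPot_eq, logPot_eq, logPot_eq,
    ← LocallyIntegrable.integral_mul_add locallyIntegrable_log_norm]
  rfl

theorem logPot_smul (c : ℝ) (φ : TestFn) (x : Plane) :
    logPot (c • φ : TestFn) x = c * logPot φ x := by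
  rw [logPot_eq, logPot_eq, ← LocallyIntegrable.integral_mul_smul]
  rfl

theorem fderiv_logPot (i : Fin 2) (φ : TestFn) (x : Plane) :
    fderiv ℝ (logPot φ) x (unitVec i) = logPot (partialD i φ) x := by
  have h := φ.hasCompactSupport.hasFDerivAt_convolution_right (ContinuousLinearMap.mul ℝ ℝ)
    locallyIntegrable_log_norm (φ.contDiff.of_le (by simp)) x
  rw [logPot, h.fderiv, convolution_precompR_apply _ locallyIntegrable_log_norm
    (φ.hasCompactSupport.fderiv ℝ) (φ.contDiff.continuous_fderiv (by simp)), logPot]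
  congr 1

theorem logPot_lapOp (φ : TestFn) (x : Plane) :
    logPot (DiffOp.app lapOp φ) x = cosMoment 0 * φ x := by
  rw [logPot_eq, ← app_lapOp_translate, integral_log_norm_mul_lapOp, TestFn.translate_zero_apply]

/-- The logarithmic potential of a test function, cut off by `η`. -/
noncomputable def cutLogPotFun (η φ : TestFn) : TestFn :=
  mulSmooth η (logPot φ) (contDiff_logPot φ.contDiff φ.hasCompactSupport)

theorem cutLogPotFun_apply (η φ : TestFn) (x : Plane) :
    cutLogPotFun η φ x = η x * logPot φ x := rfl

theorem continuous_cutLogPotFun_comp (η : TestFn) (K : TopologicalSpace.Compacts Plane)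
    (hK : (K : Set Plane) ⊆ (⊤ : TopologicalSpace.Opens Plane)) :
    Continuous (cutLogPotFun η ∘ TestFunction.ofSupportedIn hK) := by
  obtain ⟨R, hR⟩ := K.isCompact.isBounded.subset_closedBall 0
  obtain ⟨R', hR'⟩ := η.hasCompactSupport.isBounded.subset_closedBall 0
  let K' : TopologicalSpace.Compacts Plane := ⟨tsupport η, η.hasCompactSupport⟩
  have hsm (f : 𝓓_{K}(Plane, ℝ)) : ContDiff ℝ ∞ (logPot f) :=
    contDiff_logPot f.contDiff f.hasCompactSupport
  let A : 𝓓_{K}(Plane, ℝ) →L[ℝ] 𝓓_{K'}(Plane, ℝ) :=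
    ContDiffMapSupportedIn.mkCLM ℝ (fun f x => η x * logPot f x)
      (fun f g x => by
        have := logPot_add (TestFunction.ofSupportedIn hK f) (TestFunction.ofSupportedIn hK g) x
        rw [← mul_add]
        exact congrArg (η x * ·) this)
      (fun c f x => by
        have := logPot_smul c (TestFunction.ofSupportedIn hK f) x
        rw [smul_eq_mul, mul_left_comm]
        exact congrArg (η x * ·) this)
      (fun f => η.contDiff.mul (hsm f))
      (fun f x hx => by
        simp only [Pi.zero_apply]
        rw [image_eq_zero_of_notMem_tsupport hx, zero_mul])
      (fun k _ => by
        have hb : ∀ i, ∃ B, ∀ x, ‖iteratedFDeriv ℝ i η x‖ ≤ B := fun i =>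
          (η.contDiff.continuous_iteratedFDeriv (mod_cast le_top)).bounded_above_of_compact_support
            (η.hasCompactSupport.iteratedFDeriv i)
        choose B hB using hb
        have hB0 : ∀ i, 0 ≤ B i := fun i => (norm_nonneg _).trans (hB i 0)
        set I := ∫ z in Metric.closedBall (0 : Plane) (R + R'), |Real.log ‖z‖|
        have hI : 0 ≤ I := integral_nonneg fun _ => abs_nonneg _
        refine ⟨Finset.range (k + 1), ∑ i ∈ Finset.range (k + 1),
          (k.choose i : ℝ) * B i * (‖ContinuousLinearMap.mul ℝ ℝ‖ * I),
          Finset.sum_nonneg fun i _ => by have := hB0 i; positivity, fun f x hx => ?_⟩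
        refine (norm_iteratedFDeriv_mul_le η.contDiff (hsm f) x (mod_cast le_top)).trans ?_
        rw [Finset.sum_mul]
        refine Finset.sum_le_sum fun i hi => ?_
        have h1 := norm_iteratedFDeriv_convolution_le locallyIntegrable_log_norm (k - i)
          (ContinuousLinearMap.mul ℝ ℝ) f.contDiff (f.tsupport_subset.trans hR)
          (fun x => f.norm_iteratedFDeriv_apply_le_seminorm_top ℝ (i := k - i) (x := x))
          (hR' hx)
        have h2 : ContDiffMapSupportedIn.seminorm ℝ Plane ℝ ⊤ K (k - i) f ≤
            ((Finset.range (k + 1)).sup fun j =>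
              ContDiffMapSupportedIn.seminorm ℝ Plane ℝ ⊤ K j) f :=
          Seminorm.le_def.1 (Finset.le_sup (f := fun j =>
              ContDiffMapSupportedIn.seminorm ℝ Plane ℝ ⊤ K j)
            (Finset.mem_range.2 (by omega : k - i < k + 1))) f
        have h3 := hB i x
        have h4 := hB0 i
        calc (k.choose i : ℝ) * ‖iteratedFDeriv ℝ i η x‖ * ‖iteratedFDeriv ℝ (k - i) (logPot f) x‖
            ≤ (k.choose i : ℝ) * B i * (‖ContinuousLinearMap.mul ℝ ℝ‖ *
              ((Finset.range (k + 1)).sup fun j =>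
                ContDiffMapSupportedIn.seminorm ℝ Plane ℝ ⊤ K j) f * I) := by
              gcongr
              refine h1.trans ?_
              gcongr
          _ = _ := by ring)
  have e : cutLogPotFun η ∘ TestFunction.ofSupportedIn hK =
      TestFunction.ofSupportedIn (Ω := ⊤) (K := K') (Set.subset_univ _) ∘ A := rfl
  rw [e]
  exact (TestFunction.continuous_ofSupportedIn _).comp A.continuous

/-- The cut-off logarithmic potential as a continuous operator on test functions. -/
noncomputable def cutLogPot (η : TestFn) : TestFn →L[ℝ] TestFn :=
  TestFunction.mkCLM ℝ (cutLogPotFun η)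
    (fun φ ψ => by
      ext x
      rw [TestFn.add_apply]
      simp only [cutLogPotFun_apply, logPot_add, mul_add])
    (fun c φ => by
      ext x
      rw [TestFn.smul_apply]
      simp only [cutLogPotFun_apply, logPot_smul]
      ring)
    (continuous_cutLogPotFun_comp η)

theorem cutLogPot_apply (η φ : TestFn) (x : Plane) :
    cutLogPot η φ x = η x * logPot φ x := rfl

/-! ### Locality -/

theorem partialD_eqOn {U : Set Plane} (hU : IsOpen U) {φ : TestFn} {f : Plane → ℝ}
    (h : Set.EqOn φ f U) (i : Fin 2) :
    Set.EqOn (partialD i φ) (fun x => fderiv ℝ f x (unitVec i)) U := by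
  intro x hx
  rw [partialD_apply, (h.eventuallyEq_of_mem (hU.mem_nhds hx)).fderiv_eq]

theorem lapOp_eqOn {U : Set Plane} (hU : IsOpen U) {φ ψ : TestFn} (h : Set.EqOn φ ψ U) :
    Set.EqOn (DiffOp.app lapOp φ) (DiffOp.app lapOp ψ) U := by
  have h1 : ∀ i {φ ψ : TestFn}, Set.EqOn φ ψ U → Set.EqOn (partialD i φ) (partialD i ψ) U := by
    intro i φ ψ h x hx
    rw [partialD_eqOn hU h i hx, partialD_apply]
  intro x hx
  rw [app_lapOp 0, app_lapOp 0, TestFn.add_apply, TestFn.add_apply, h1 _ (h1 _ h) hx,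
    h1 _ (h1 _ h) hx]

theorem lapOp_pow_eqOn {U : Set Plane} (hU : IsOpen U) {φ ψ : TestFn} (h : Set.EqOn φ ψ U)
    (M : ℕ) : Set.EqOn (DiffOp.app (lapOp ^ M) φ) (DiffOp.app (lapOp ^ M) ψ) U := by
  induction M with
  | zero => simpa [DiffOp.app_one] using h
  | succ M ih =>
    rw [pow_succ', DiffOp.app_mul, DiffOp.app_mul]
    exact lapOp_eqOn hU ih

theorem lapOp_cutLogPot_eqOn {U : Set Plane} (hU : IsOpen U) {η : TestFn}
    (hη : ∀ x ∈ U, η x = 1) (φ : TestFn) :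
    Set.EqOn (DiffOp.app lapOp (cutLogPot η φ)) (cosMoment 0 • φ : TestFn) U := by
  have h1 : Set.EqOn (cutLogPot η φ) (logPot φ) U := by
    intro x hx
    rw [cutLogPot_apply, hη x hx, one_mul]
  have h2 {ψ χ : TestFn} (h : Set.EqOn ψ (logPot χ) U) (i : Fin 2) :
      Set.EqOn (partialD i ψ) (logPot (partialD i χ)) U := by
    intro x hx
    rw [partialD_eqOn hU h i hx]
    exact fderiv_logPot i χ x
  intro x hx
  rw [app_lapOp 0, TestFn.add_apply, h2 (h2 h1 _) _ hx, h2 (h2 h1 _) _ hx, ← logPot_add,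
    ← app_lapOp 0, logPot_lapOp, TestFn.smul_apply]

theorem lapOp_pow_cutLogPot_pow_eqOn {U : Set Plane} (hU : IsOpen U) {η : TestFn}
    (hη : ∀ x ∈ U, η x = 1) (φ : TestFn) (M : ℕ) :
    Set.EqOn (DiffOp.app (lapOp ^ M) ((cutLogPot η ^ M) φ)) (cosMoment 0 ^ M • φ : TestFn) U := by
  induction M with
  | zero =>
    intro x _
    simp [DiffOp.app_one]
  | succ M ih =>
    intro x hx
    have e : (cutLogPot η ^ (M + 1)) φ = cutLogPot η ((cutLogPot η ^ M) φ) := by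
      rw [pow_succ']
      rfl
    rw [e, pow_succ, DiffOp.app_mul,
      lapOp_pow_eqOn hU (lapOp_cutLogPot_eqOn hU hη ((cutLogPot η ^ M) φ)) M hx]
    have e2 : DiffOp.app (lapOp ^ M) (cosMoment 0 • (cutLogPot η ^ M) φ) =
        cosMoment 0 • DiffOp.app (lapOp ^ M) ((cutLogPot η ^ M) φ) := map_smul _ _ _
    rw [e2, TestFn.smul_apply, ih hx, TestFn.smul_apply, TestFn.smul_apply]
    ring

/-! ### Test functions as integrable functions -/

theorem TestFn.integrable (φ : TestFn) : Integrable (φ : Plane → ℝ) :=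
  φ.continuous.integrable_of_hasCompactSupport φ.hasCompactSupport

theorem continuous_toL1_comp (K : TopologicalSpace.Compacts Plane)
    (hK : (K : Set Plane) ⊆ (⊤ : TopologicalSpace.Opens Plane)) :
    Continuous ((fun φ : TestFn => (TestFn.integrable φ).toL1 (φ : Plane → ℝ)) ∘
      TestFunction.ofSupportedIn hK) := by
  let A : 𝓓_{K}(Plane, ℝ) →L[ℝ] Lp ℝ 1 (volume : Measure Plane) :=
    ContDiffMapSupportedIn.mkCLMtoNormedSpace ℝ
      (fun f => (TestFn.integrable (TestFunction.ofSupportedIn hK f)).toL1 _)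
      (fun _ _ => Integrable.toL1_add _ _ _ _)
      (fun c f => Integrable.toL1_smul _ (TestFn.integrable (TestFunction.ofSupportedIn hK f)) c)
      (by
        refine ⟨{0}, volume.real (K : Set Plane), measureReal_nonneg, fun f => ?_⟩
        rw [L1.norm_of_fun_eq_integral_norm, Finset.sup_singleton]
        change ∫ a, ‖f a‖ ≤ _
        rw [← setIntegral_eq_integral_of_forall_compl_eq_zero (s := (K : Set Plane))
          (fun x hx => by rw [f.zero_on_compl hx]; simp)]
        have h := norm_setIntegral_le_of_norm_le_const (μ := volume) (s := (K : Set Plane))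
          (f := fun a => ‖f a‖) K.isCompact.measure_lt_top (fun x _ => by
            rw [norm_norm]; exact f.norm_apply_le_seminorm ℝ)
        rw [mul_comm]
        exact (le_abs_self _).trans h)
  exact A.continuous

/-- The inclusion of test functions into `L¹`. -/
noncomputable def toL1 : TestFn →L[ℝ] Lp ℝ 1 (volume : Measure Plane) :=
  TestFunction.mkCLM ℝ (fun φ : TestFn => (TestFn.integrable φ).toL1 (φ : Plane → ℝ))
    (fun _ _ => Integrable.toL1_add _ _ _ _)
    (fun c φ => Integrable.toL1_smul _ (TestFn.integrable φ) c)
    continuous_toL1_comp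

theorem norm_toL1 (φ : TestFn) : ‖toL1 φ‖ = ∫ x, |φ x| :=
  L1.norm_of_fun_eq_integral_norm (TestFn.integrable φ)

theorem coeFn_toL1 (φ : TestFn) : toL1 φ =ᵐ[volume] φ :=
  (TestFn.integrable φ).coeFn_toL1

/-! ### Functionals dominated by the `L¹` norm -/

theorem continuous_one_add_norm_rpow (r : ℝ) : Continuous fun x : Plane => (1 + ‖x‖) ^ r :=
  (continuous_const.add continuous_norm).rpow_const
    fun x => Or.inl (add_pos_of_pos_of_nonneg one_pos (norm_nonneg x)).ne'

theorem integrable_plane_weight : Integrable fun x : Plane => (1 + ‖x‖) ^ (-3 : ℝ) :=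
  integrable_one_add_norm (by simp; norm_num)

theorem memLp_plane_weight : MemLp (fun x : Plane => (1 + ‖x‖) ^ (-3 : ℝ)) 2 volume := by
  rw [memLp_two_iff_integrable_sq (continuous_one_add_norm_rpow _).aestronglyMeasurable]
  have h : Integrable fun x : Plane => (1 + ‖x‖) ^ (-6 : ℝ) :=
    integrable_one_add_norm (by simp; norm_num)
  refine h.congr (Eventually.of_forall fun x => ?_)
  simp only
  rw [← Real.rpow_natCast, ← Real.rpow_mul (by positivity)]
  norm_num

/-- A functional on `L¹(ℝ²)` of norm at most one is represented by an essentially bounded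
function, at least on test functions. -/
theorem exists_Linfty_representative (Λ : Lp ℝ 1 (volume : Measure Plane) →L[ℝ] ℝ)
    (hΛ : ‖Λ‖ ≤ 1) : InUnitBallLinfty fun φ => Λ (toL1 φ) := by
  set w : Plane → ℝ := fun x => (1 + ‖x‖) ^ (-3 : ℝ) with hw
  have hwpos : ∀ x, 0 < w x := fun x => by simp only [hw]; positivity
  have hwc : Continuous w := continuous_one_add_norm_rpow _
  have hwi : Integrable w := integrable_plane_weight
  have hw2 : MemLp w 2 volume := memLp_plane_weight
  let B : Lp ℝ 2 (volume : Measure Plane) →L[ℝ] Lp ℝ 1 (volume : Measure Plane) :=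
    (ContinuousLinearMap.mul ℝ ℝ).holderL volume 2 2 1 (hw2.toLp w)
  have hB (g : Lp ℝ 2 (volume : Measure Plane)) : B g =ᵐ[volume] fun x => w x * g x := by
    have h1 : B g =ᵐ[volume] fun x => (hw2.toLp w) x * g x :=
      (ContinuousLinearMap.mul ℝ ℝ).coeFn_holder (hw2.toLp w) g
    filter_upwards [h1, hw2.coeFn_toLp] with x hx hx'
    rw [hx, hx']
  let h : Lp ℝ 2 (volume : Measure Plane) := (InnerProductSpace.toDual ℝ _).symm (Λ.comp B)
  have hrep (g : Lp ℝ 2 (volume : Measure Plane)) : Λ (B g) = ∫ x, h x * g x := by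
    have h1 : inner ℝ h g = (Λ.comp B) g := InnerProductSpace.toDual_symm_apply
    rw [L2.inner_def] at h1
    rw [← ContinuousLinearMap.comp_apply, ← h1]
    refine integral_congr_ae (Eventually.of_forall fun x => ?_)
    simp [mul_comm]
  have hbound {s : Set Plane} (hs : MeasurableSet s) (hμ : volume s < ⊤) :
      |∫ x in s, h x| ≤ ∫ x in s, w x := by
    let g := indicatorConstLp 2 hs hμ.ne (1 : ℝ)
    have hg : g =ᵐ[volume] s.indicator fun _ => (1 : ℝ) := indicatorConstLp_coeFn
    have e1 : ∫ x in s, h x = Λ (B g) := by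
      rw [hrep, ← integral_indicator hs]
      refine integral_congr_ae ?_
      filter_upwards [hg] with x hx
      rw [hx]
      by_cases hxs : x ∈ s <;> simp [hxs]
    have e2 : ‖B g‖ = ∫ x in s, w x := by
      rw [L1.norm_eq_integral_norm, ← integral_indicator hs]
      refine integral_congr_ae ?_
      filter_upwards [hg, hB g] with x hx hx'
      rw [hx', hx]
      by_cases hxs : x ∈ s <;> simp [hxs, (hwpos x).le]
    rw [e1, ← e2, ← Real.norm_eq_abs]
    exact (Λ.le_opNorm _).trans (mul_le_of_le_one_left (norm_nonneg _) hΛ)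
  have hhint {s : Set Plane} (hμ : volume s < ⊤) : IntegrableOn h s := by
    have : IsFiniteMeasure (volume.restrict s) := ⟨by simpa using hμ⟩
    exact ((Lp.memLp h).restrict s).integrable (by norm_num)
  have hle1 : ∀ᵐ x, 0 ≤ w x - h x := by
    refine ae_nonneg_of_forall_setIntegral_nonneg_of_sigmaFinite
      (fun s _ hμ => hwi.integrableOn.sub (hhint hμ)) fun s hs hμ => ?_
    rw [integral_sub hwi.integrableOn (hhint hμ)]
    linarith [le_abs_self (∫ x in s, h x), hbound hs hμ]
  have hle2 : ∀ᵐ x, 0 ≤ w x + h x := by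
    refine ae_nonneg_of_forall_setIntegral_nonneg_of_sigmaFinite
      (fun s _ hμ => hwi.integrableOn.add (hhint hμ)) fun s hs hμ => ?_
    rw [integral_add hwi.integrableOn (hhint hμ)]
    linarith [neg_abs_le (∫ x in s, h x), hbound hs hμ]
  have hquot : ∀ᵐ x, ‖h x / w x‖ ≤ 1 := by
    filter_upwards [hle1, hle2] with x h1 h2
    rw [norm_div, Real.norm_of_nonneg (hwpos x).le, div_le_one (hwpos x), Real.norm_eq_abs,
      abs_le]
    constructor <;> linarith
  have hmeas : AEStronglyMeasurable (fun x => h x / w x) volume :=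
    ((Lp.aestronglyMeasurable h).aemeasurable.div
      hwc.aemeasurable).aestronglyMeasurable
  have hmem : MemLp (fun x => h x / w x) ∞ volume := memLp_top_of_bound hmeas 1 hquot
  refine ⟨hmem.toLp _, ?_, fun φ => ?_⟩
  · rw [Lp.norm_toLp, eLpNorm_exponent_top]
    refine ENNReal.toReal_le_of_le_ofReal zero_le_one ?_
    exact eLpNormEssSup_le_of_ae_bound hquot
  · have hgc : Continuous fun x => φ x / w x := φ.continuous.div hwc fun x => (hwpos x).ne'
    have hgm : MemLp (fun x => φ x / w x) 2 volume := by
      refine hgc.memLp_of_hasCompactSupport ?_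
      simp only [div_eq_mul_inv]
      exact φ.hasCompactSupport.mul_right
    have e : toL1 φ = B (hgm.toLp _) := by
      refine Lp.ext ?_
      filter_upwards [coeFn_toL1 φ, hB (hgm.toLp _), hgm.coeFn_toLp] with x h1 h2 h3
      rw [h1, h2, h3, mul_div_cancel₀ _ (hwpos x).ne']
    change Λ (toL1 φ) = _
    rw [e, hrep]
    refine integral_congr_ae ?_
    filter_upwards [hgm.coeFn_toLp, hmem.coeFn_toLp] with x h1 h2
    rw [h1, h2]
    ring

/-- A linear functional on test functions that is dominated by the `L¹` norm lies in the closed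
unit ball of `L^∞`. -/
theorem inUnitBallLinfty_of_le (S : TestFn →ₗ[ℝ] ℝ) (hS : ∀ φ, |S φ| ≤ ‖toL1 φ‖) :
    InUnitBallLinfty S := by
  let T : TestFn →ₗ[ℝ] Lp ℝ 1 (volume : Measure Plane) := toL1.toLinearMap
  obtain ⟨g, hg⟩ := T.rangeRestrict.exists_rightInverse_of_surjective T.range_rangeRestrict
  have hTg (y : LinearMap.range T) : toL1 (g y) = y :=
    congrArg Subtype.val (LinearMap.congr_fun hg y)
  let f : StrongDual ℝ (LinearMap.range T) := (S.comp g).mkContinuous 1 fun y => by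
    rw [one_mul, LinearMap.comp_apply, Real.norm_eq_abs]
    refine (hS _).trans_eq ?_
    rw [hTg]
    rfl
  obtain ⟨Λ, hΛ, hn⟩ := exists_extension_norm_eq (LinearMap.range T) f
  have hΛ1 : ‖Λ‖ ≤ 1 := hn.trans_le (LinearMap.mkContinuous_norm_le _ zero_le_one _)
  obtain ⟨F, hF, hrep⟩ := exists_Linfty_representative Λ hΛ1
  refine ⟨F, hF, fun φ => ?_⟩
  rw [← hrep]
  have h1 : Λ (toL1 φ) = S (g ⟨toL1 φ, φ, rfl⟩) := hΛ ⟨toL1 φ, φ, rfl⟩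
  have h2 := hS (φ - g ⟨toL1 φ, φ, rfl⟩)
  rw [map_sub, map_sub, hTg, sub_self, norm_zero] at h2
  simp only
  rw [h1]
  exact sub_eq_zero.1 (abs_nonpos_iff.1 h2)

theorem InUnitBallLinfty.abs_le {S : TestFn → ℝ} (hS : InUnitBallLinfty S) (φ : TestFn) :
    |S φ| ≤ ‖toL1 φ‖ := by
  obtain ⟨f, hf, hrep⟩ := hS
  rw [hrep, norm_toL1, ← Real.norm_eq_abs]
  refine norm_integral_le_of_norm_le (TestFn.integrable φ).abs ?_
  have h : ∀ᵐ x, ‖f x‖ ≤ ‖f‖ := by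
    have h1 := ae_le_eLpNormEssSup (f := f) (μ := (volume : Measure Plane))
    filter_upwards [h1] with x hx
    rw [Lp.norm_def, eLpNorm_exponent_top, ← toReal_enorm]
    refine ENNReal.toReal_mono ?_ hx
    rw [← eLpNorm_exponent_top]
    exact Lp.eLpNorm_ne_top f
  filter_upwards [h] with x hx
  rw [norm_mul, Real.norm_eq_abs (φ x)]
  exact mul_le_of_le_one_left (abs_nonneg _) (hx.trans hf)

/-! ### Uniform bounds for admissible distributions -/

/-- A distribution only depends on the test function near its support. -/
theorem RealDistrib.congr_of_eventually {T : RealDistrib} {φ ψ : TestFn}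
    (h : ∀ᶠ x in 𝓝ˢ (Distribution.dsupport T), φ x = ψ x) : T φ = T ψ := by
  rw [← sub_eq_zero, ← map_sub]
  apply isVanishingOn_compl_dsupport T
  intro x hx hxT
  refine (notMem_tsupport_iff_eventuallyEq.2 ?_) hx
  filter_upwards [h.filter_mono (nhds_le_nhdsSet hxT)] with y hy
  change φ y - ψ y = 0
  rw [hy, sub_self]

theorem pairSmooth_eq_of_testFn {T : RealDistrib} (hT : IsCompact (Distribution.dsupport T))
    {g : Plane → ℝ} (hg : ContDiff ℝ ∞ g) {ψ : TestFn} (h : ∀ x, g x = ψ x) :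
    pairSmooth T hT g hg = T ψ := by
  refine RealDistrib.congr_of_eventually ?_
  filter_upwards [cutoff_eventually hT] with x hx
  change cutoff hT x * g x = ψ x
  rw [hx, one_mul, h]

theorem potential_lapOp_pow (m : ℕ) (i : Fin 2) {T : RealDistrib}
    (hT : IsCompact (Distribution.dsupport T)) (ψ : TestFn) :
    potential (m + 1) i T hT (DiffOp.app (lapOp ^ (m + 1)) ψ) =
      -((2 * m + 1) * cosMoment m) * T (DiffOp.app (kernOp m i) ψ) := by
  have h := pairSmooth_eq_of_testFn hT (contDiff_kernAdj (m + 1) i _)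
    (ψ := -((2 * m + 1) * cosMoment m) • DiffOp.app (kernOp m i) ψ)
    (fun x => kernAdj_lapOp_pow m i ψ x)
  rw [map_smul, smul_eq_mul] at h
  exact h

theorem Admissible.abs_kernOp_le {m : ℕ} {E : Set Plane} {T : RealDistrib}
    (h : Admissible (m + 1) E T) (i : Fin 2) (ψ : TestFn) :
    |T (DiffOp.app (kernOp m i) ψ)| ≤
      ((2 * m + 1) * cosMoment m)⁻¹ * ‖toL1 (DiffOp.app (lapOp ^ (m + 1)) ψ)‖ := by
  have h1 := (h.bounded i).abs_le (DiffOp.app (lapOp ^ (m + 1)) ψ)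
  have hc : 0 < (2 * m + 1) * cosMoment m := mul_pos (by positivity) (cosMoment_pos m)
  rw [potential_lapOp_pow, abs_mul, abs_neg, abs_of_pos hc] at h1
  rwa [← div_eq_inv_mul, le_div_iff₀' hc]

/-- The admissible distributions of a compact set are dominated by a common continuous gauge. -/
theorem exists_gauge (m : ℕ) {E : Set Plane} (hE : IsCompact E) :
    ∃ q : TestFn → ℝ, Continuous q ∧ q 0 = 0 ∧
      ∀ T : RealDistrib, Admissible (m + 1) E T → ∀ φ, |T φ| ≤ q φ := by
  obtain ⟨M, a, b, hab⟩ := exists_sq_add_sq_pow_eq m (dOp 0) (dOp 1)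
  have hdec : lapOp ^ M = kernOp m 0 * a + kernOp m 1 * b := by
    rw [mul_comm, mul_comm _ b]
    exact hab
  obtain ⟨U, hU, hEU, hη⟩ := mem_nhdsSet_iff_exists.1 (cutoff_eventually hE)
  let J := cutLogPot (cutoff hE) ^ M
  set c := (cosMoment 0 ^ M)⁻¹ * ((2 * m + 1) * cosMoment m)⁻¹
  have hcont (A : DiffOp) : Continuous fun φ => ‖toL1 (DiffOp.app (lapOp ^ (m + 1))
      (DiffOp.app A (J φ)))‖ :=
    (toL1.continuous.comp ((lapOp ^ (m + 1)).1.continuous.comp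
      (A.1.continuous.comp J.continuous))).norm
  have hzero (A : DiffOp) : DiffOp.app A 0 = 0 := map_zero A.1
  refine ⟨fun φ => c * (‖toL1 (DiffOp.app (lapOp ^ (m + 1)) (DiffOp.app a (J φ)))‖ +
    ‖toL1 (DiffOp.app (lapOp ^ (m + 1)) (DiffOp.app b (J φ)))‖),
    continuous_const.mul ((hcont a).add (hcont b)), by simp [hzero], fun T hT φ => ?_⟩
  have hC : 0 < cosMoment 0 ^ M := pow_pos (cosMoment_pos 0) M
  have h1 : T (DiffOp.app (lapOp ^ M) (J φ)) = cosMoment 0 ^ M * T φ := by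
    rw [← smul_eq_mul, ← map_smul]
    refine RealDistrib.congr_of_eventually ?_
    filter_upwards [mem_nhdsSet_iff_exists.2 ⟨U, hU, hT.subset.trans hEU, subset_rfl⟩] with x hx
    exact lapOp_pow_cutLogPot_pow_eqOn hU (fun x hx => hη hx) φ M hx
  rw [hdec, DiffOp.app_add, map_add, DiffOp.app_mul, DiffOp.app_mul] at h1
  have h2 : T φ = (cosMoment 0 ^ M)⁻¹ * (T (DiffOp.app (kernOp m 0) (DiffOp.app a (J φ))) +
      T (DiffOp.app (kernOp m 1) (DiffOp.app b (J φ)))) := by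
    rw [h1, inv_mul_cancel_left₀ hC.ne']
  rw [h2, abs_mul, abs_of_pos (inv_pos.2 hC)]
  change _ ≤ (cosMoment 0 ^ M)⁻¹ * ((2 * m + 1) * cosMoment m)⁻¹ * (_ + _)
  rw [mul_assoc, mul_add]
  gcongr
  exact (abs_add_le _ _).trans (add_le_add (hT.abs_kernOp_le 0 _) (hT.abs_kernOp_le 1 _))

theorem Admissible.mono {n : ℕ} {E F : Set Plane} (hEF : E ⊆ F) {T : RealDistrib}
    (h : Admissible n E T) : Admissible n F T :=
  ⟨h.isCompact, h.subset.trans hEF, h.bounded⟩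

theorem gammaCap_mono {n : ℕ} {E F : Set Plane} (hEF : E ⊆ F) : gammaCap n E ≤ gammaCap n F :=
  iSup_le fun T => iSup_le fun hT =>
    le_iSup₂_of_le (f := fun (T : RealDistrib) (hT : Admissible n F T) =>
      ENNReal.ofReal |pairSmooth T hT.isCompact (fun _ => 1) contDiff_const|) T (hT.mono hEF) le_rfl

/-- Pairings of distributions supported in a compact set can be computed with its cut-off. -/
theorem pairSmooth_eq_cutoff {E : Set Plane} (hE : IsCompact E) {T : RealDistrib}
    (hT : IsCompact (Distribution.dsupport T)) (hTE : Distribution.dsupport T ⊆ E)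
    (g : Plane → ℝ) (hg : ContDiff ℝ ∞ g) :
    pairSmooth T hT g hg = T (mulSmooth (cutoff hE) g hg) :=
  pairSmooth_eq T hT g hg _ ((cutoff_eventually hE).filter_mono (nhdsSet_mono hTE))

theorem gammaCap_lt_top (m : ℕ) {E : Set Plane} (hE : IsCompact E) : gammaCap (m + 1) E < ⊤ := by
  obtain ⟨q, -, -, hq⟩ := exists_gauge m hE
  refine lt_of_le_of_lt (iSup_le fun T => iSup_le fun hT => ?_)
    (ENNReal.ofReal_lt_top (r := q (mulSmooth (cutoff hE) (fun _ => 1) contDiff_const)))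
  rw [pairSmooth_eq_cutoff hE hT.isCompact hT.subset]
  exact ENNReal.ofReal_le_ofReal (hq T hT _)

/-! ### Limits of distributions -/

/-- A sequence of distributions dominated by a continuous gauge converges weakly along an
ultrafilter. -/
theorem exists_tendsto_of_gauge {q : TestFn → ℝ} (hq : Continuous q) (hq0 : q 0 = 0)
    {T : ℕ → RealDistrib} (hT : ∀ k φ, |T k φ| ≤ q φ) (𝒰 : Ultrafilter ℕ) :
    ∃ S : RealDistrib, ∀ φ, Tendsto (fun k => T k φ) 𝒰 (𝓝 (S φ)) := by
  have hlim (φ : TestFn) : ∃ y, |y| ≤ q φ ∧ Tendsto (fun k => T k φ) 𝒰 (𝓝 y) := by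
    obtain ⟨y, hy, hle⟩ := (isCompact_Icc (a := -q φ) (b := q φ)).ultrafilter_le_nhds'
      (𝒰.map fun k => T k φ)
        (mem_map.2 (univ_mem' fun k => abs_le.1 (hT k φ)))
    exact ⟨y, abs_le.2 hy, hle⟩
  choose f hfq hf using hlim
  let L : TestFn →ₗ[ℝ] ℝ :=
    { toFun := f
      map_add' := fun φ ψ => tendsto_nhds_unique (hf (φ + ψ)) (by
        simpa only [map_add] using (hf φ).add (hf ψ))
      map_smul' := fun c φ => tendsto_nhds_unique (hf (c • φ)) (by
        simp only [map_smul, RingHom.id_apply]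
        exact (hf φ).const_smul c) }
  have hL : Continuous L := by
    refine continuous_of_continuousAt_zero L ?_
    rw [ContinuousAt, map_zero]
    refine squeeze_zero_norm (a := q) hfq ?_
    rw [← hq0]
    exact hq.tendsto 0
  exact ⟨{ toFun := L, map_add' := L.map_add, map_smul' := L.map_smul, cont := hL }, hf⟩

theorem dsupport_subset_of_tendsto {T : ℕ → RealDistrib} {S : RealDistrib} {l : Filter ℕ} [l.NeBot]
    (h : ∀ φ, Tendsto (fun k => T k φ) l (𝓝 (S φ))) {F : Set Plane} (hF : IsClosed F)
    (hT : ∀ᶠ k in l, Distribution.dsupport (T k) ⊆ F) : Distribution.dsupport S ⊆ F := by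
  refine Set.sInter_subset_of_mem ⟨fun u hu => ?_, hF⟩
  refine tendsto_nhds_unique (h u) (tendsto_const_nhds.congr' ?_)
  filter_upwards [hT] with k hk
  exact (isVanishingOn_compl_dsupport (T k) u (hu.trans (Set.compl_subset_compl.2 hk))).symm

theorem kernAdj_add (n : ℕ) (i : Fin 2) (φ ψ : TestFn) (x : Plane) :
    kernAdj n i (φ + ψ) x = kernAdj n i φ x + kernAdj n i ψ x := by
  rw [kernAdj_eq, kernAdj_eq, kernAdj_eq,
    ← LocallyIntegrable.integral_mul_add (locallyIntegrable_kern n i)]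
  rfl

theorem kernAdj_smul (n : ℕ) (i : Fin 2) (c : ℝ) (φ : TestFn) (x : Plane) :
    kernAdj n i (c • φ) x = c * kernAdj n i φ x := by
  rw [kernAdj_eq, kernAdj_eq, ← LocallyIntegrable.integral_mul_smul]
  rfl

/-- The potential is linear in the test function. -/
noncomputable def potentialₗ (n : ℕ) (i : Fin 2) (T : RealDistrib)
    (hT : IsCompact (Distribution.dsupport T)) : TestFn →ₗ[ℝ] ℝ where
  toFun := potential n i T hT
  map_add' φ ψ := by
    rw [potential, pairSmooth, potential, pairSmooth, potential, pairSmooth, ← map_add]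
    congr 1
    ext x
    change cutoff hT x * kernAdj n i (φ + ψ) x =
      cutoff hT x * kernAdj n i φ x + cutoff hT x * kernAdj n i ψ x
    rw [kernAdj_add, mul_add]
  map_smul' c φ := by
    rw [potential, pairSmooth, potential, pairSmooth, RingHom.id_apply, ← map_smul]
    congr 1
    ext x
    change cutoff hT x * kernAdj n i (c • φ) x = c * (cutoff hT x * kernAdj n i φ x)
    rw [kernAdj_smul, mul_left_comm]

/-- A weak limit of admissible distributions of compact sets that shrink to `⋂ k, E k` is
admissible for the intersection. -/
theorem Admissible.of_tendsto {n : ℕ} {E : ℕ → Set Plane} (hE : ∀ k, IsCompact (E k))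
    (hdecr : Antitone E) {T : ℕ → RealDistrib} (hT : ∀ k, Admissible n (E k) (T k))
    {S : RealDistrib} {l : Filter ℕ} [l.NeBot] (hl : l ≤ atTop)
    (h : ∀ φ, Tendsto (fun k => T k φ) l (𝓝 (S φ))) : Admissible n (⋂ k, E k) S := by
  have hsupp (k : ℕ) : Distribution.dsupport S ⊆ E k := by
    refine dsupport_subset_of_tendsto h (hE k).isClosed (hl ?_)
    filter_upwards [eventually_ge_atTop k] with j hj
    exact (hT j).subset.trans (hdecr hj)
  have hc : IsCompact (Distribution.dsupport S) :=
    (hE 0).of_isClosed_subset Distribution.isClosed_dsupport (hsupp 0)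
  refine ⟨hc, Set.subset_iInter hsupp, fun i => ?_⟩
  refine inUnitBallLinfty_of_le (potentialₗ n i S hc) fun φ => ?_
  have e1 (k : ℕ) : potential n i (T k) (hT k).isCompact φ =
      T k (mulSmooth (cutoff (hE 0)) _ (contDiff_kernAdj n i φ)) :=
    pairSmooth_eq_cutoff (hE 0) _ ((hT k).subset.trans (hdecr k.zero_le)) _ _
  have e2 : potentialₗ n i S hc φ =
      S (mulSmooth (cutoff (hE 0)) _ (contDiff_kernAdj n i φ)) :=
    pairSmooth_eq_cutoff (hE 0) _ (hsupp 0) _ _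
  rw [e2]
  refine le_of_tendsto (h _).abs (Eventually.of_forall fun k => ?_)
  rw [← e1]
  exact ((hT k).bounded i).abs_le φ

theorem iInf_gammaCap_le (m : ℕ) {E : ℕ → Set Plane} (hE : ∀ k, IsCompact (E k))
    (hdecr : Antitone E) : ⨅ k, gammaCap (m + 1) (E k) ≤ gammaCap (m + 1) (⋂ k, E k) := by
  refine le_of_forall_lt_imp_le_of_dense fun c hc => ?_
  have hex (k : ℕ) : ∃ T, ∃ hT : Admissible (m + 1) (E k) T,
      c < ENNReal.ofReal |pairSmooth T hT.isCompact (fun _ => 1) contDiff_const| := by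
    have := hc.trans_le (iInf_le _ k)
    simpa only [gammaCap, lt_iSup_iff] using this
  choose T hT hcT using hex
  obtain ⟨q, hq, hq0, hqT⟩ := exists_gauge m (hE 0)
  obtain ⟨S, hS⟩ := exists_tendsto_of_gauge hq hq0
    (fun k => hqT (T k) ((hT k).mono (hdecr k.zero_le))) (hyperfilter ℕ)
  have hadm := Admissible.of_tendsto hE hdecr hT Nat.hyperfilter_le_atTop hS
  refine le_trans ?_ (le_iSup₂ (f := fun (T : RealDistrib) (hT : Admissible (m + 1) (⋂ k, E k) T) =>
    ENNReal.ofReal |pairSmooth T hT.isCompact (fun _ => 1) contDiff_const|) S hadm)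
  rw [pairSmooth_eq_cutoff (hE 0) hadm.isCompact (hadm.subset.trans (Set.iInter_subset _ 0))]
  refine ge_of_tendsto ((ENNReal.continuous_ofReal.tendsto _).comp (hS _).abs)
    (Eventually.of_forall fun k => ?_)
  rw [Function.comp_apply, ← pairSmooth_eq_cutoff (hE 0) (hT k).isCompact
    ((hT k).subset.trans (hdecr k.zero_le))]
  exact (hcT k).le

theorem mainTheorem8 (n : ℕ) (hn : 1 ≤ n) (E : ℕ → Set Plane) (hE : ∀ k, IsCompact (E k))
    (hdecr : Antitone E) :
    (∀ k, gammaCap n (E k) < ⊤) ∧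
      Tendsto (fun k => gammaCap n (E k)) atTop (𝓝 (gammaCap n (⋂ k, E k))) := by
  obtain ⟨m, rfl⟩ := Nat.exists_eq_add_of_le' hn
  refine ⟨fun k => gammaCap_lt_top m (hE k), ?_⟩
  have h : gammaCap (m + 1) (⋂ k, E k) = ⨅ k, gammaCap (m + 1) (E k) :=
    le_antisymm (le_iInf fun k => gammaCap_mono (Set.iInter_subset _ k))
      (iInf_gammaCap_le m hE hdecr)
  rw [h]
  exact tendsto_atTop_iInf fun _ _ hjk => gammaCap_mono (hdecr hjk)
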